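/- Let $N\ge 1$, let $\Omega\subset\mathbb{R}^N$ be a bounded open set, let $s\in(0,1)$, and let $p:\mathbb{R}^N\times\mathbb{R}^N\to(1,\infty)$ be continuous and symmetric, $p(x,y)=p(y,x)$, with $$1<p^-:=\inf_{\mathbb{R}^N\times\mathbb{R}^N}p\le p^+:=\sup_{\mathbb{R}^N\times\mathbb{R}^N}p<\infty .$$ Let $K$ be a measurable symmetric kernel, $K(x,y)=K(y,x)$, with $K(x,y)>0$ for $x\neq y$, such that * there is $k_0>0$ with $K(x,y)\ge k_0|x-y|^{-(N+sp(x,y))}$ for all $x\ne y$; * $\min\{1,|x-y|^{p(x,y)}\}\,K(x,y)\in L^1(\Omega\times\mathbb{R}^N)$. Put $Q=(\mathbb{R}^N\times\mathbb{R}^N)\setminus\big((\mathbb{R}^N\setminus\Omega)\times(\mathbb{R}^N\setminus\Omega)\big)$ and $$\rho(u)=\int_Q|u(x)-u(y)|^{p(x,y)}K(x,y)\,dx\,dy .$$ Let $W_0=W_0^{K,p(x,y)}(\Omega)$ be the space of measurable functions $u:\mathbb{R}^N\to\mathbb{R}$ (identified when they agree almost everywhere) such that $u=0$ a.e. in $\mathbb{R}^N\setminus\Omega$,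 $\int_\Omega|u(x)|^{p(x,x)}\,dx<\infty$, and $\rho(u/\lambda)<\infty$ for some $\lambda>0$, with the norm $\|u\|_{W_0}=[u]_{K,p(x,y)}=\inf\{\lambda>0:\rho(u/\lambda)\le1\}$. Let $W_0^*$ be its dual space. For $u,\varphi\in W_0$ let $$\langle \mathcal{L}^{p(x,\cdot)}_K(u),\varphi\rangle=\int_{\mathbb{R}^{2N}}|u(x)-u(y)|^{p(x,y)-2}(u(x)-u(y))(\varphi(x)-\varphi(y))K(x,y)\,dx\,dy .$$ Then, writing $\mathcal{L}=\mathcal{L}^{p(x,\cdot)}_K$: 1. $\mathcal{L}:W_0\to W_0^*$ is well defined (the integral converges absolutely for all $u,\varphi\in W_0$ and, for fixed $u$, is a continuous linear functional of $\varphi$), and $\mathcal{L}$ is bounded, that is, it maps bounded sets to bounded sets. 2. $\mathcal{L}$ is strictly monotone: $\langle\mathcal{L}(u)-\mathcal{L}(v),u-v\rangle>0$ for all $u\neq v$ in $W_0$. 3. $\mathcal{L}$ is of type $(S_+)$: if $u_k\rightharpoonup u$ weakly in $W_0$ and $\limsup_{k\to\infty}\langle\mathcal{L}(u_k)-\mathcal{L}(u),u_k-u\rangle\le0$,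 then $u_k\to u$ strongly in $W_0$. 4. $\mathcal{L}:W_0\to W_0^*$ is a homeomorphism. 5. $\mathcal{L}$ is coercive: $\langle\mathcal{L}(u),u\rangle/\|u\|_{W_0}\to+\infty$ as $\|u\|_{W_0}\to\infty$. -/

import Mathlib

open MeasureTheory Filter Topology Set
open scoped ENNReal

noncomputable section

/-- The data of the nonlocal problem: a bounded open set `Ω` of `ℝ^N`, `N ≥ 1`, an order
`s ∈ (0, 1)`, a continuous symmetric exponent `p` with `1 < p⁻ ≤ p ≤ p⁺ < ∞` and a symmetric
positive singular kernel `K`. -/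
structure KernelSetting (N : ℕ) where
  N_pos : 0 < N
  Ω : Set (EuclideanSpace ℝ (Fin N))
  Ω_open : IsOpen Ω
  Ω_bounded : Bornology.IsBounded Ω
  s : ℝ
  s_pos : 0 < s
  s_lt_one : s < 1
  p : EuclideanSpace ℝ (Fin N) × EuclideanSpace ℝ (Fin N) → ℝ
  p_continuous : Continuous p
  p_lower : ∃ a : ℝ, 1 < a ∧ ∀ z, a ≤ p z
  p_upper : ∃ b : ℝ, ∀ z, p z ≤ b
  p_symm : ∀ x y, p (x, y) = p (y, x)
  K : EuclideanSpace ℝ (Fin N) × EuclideanSpace ℝ (Fin N) → ℝ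
  /-- `K` is Lebesgue measurable. -/
  K_measurable : AEMeasurable K volume
  /-- `K` is positive; the values on the diagonal, a null set, are left free, so that
  `|x - y|^{-(N + s p(x, y))}` is an admissible kernel. -/
  K_pos : ∀ x y, x ≠ y → 0 < K (x, y)
  K_symm : ∀ x y, K (x, y) = K (y, x)
  K_lower : ∃ k₀ : ℝ, 0 < k₀ ∧
    ∀ x y, x ≠ y → k₀ * ‖x - y‖ ^ (-((N : ℝ) + s * p (x, y))) ≤ K (x, y)
  /-- `min {1, |x - y|^{p(x, y)}} K(x, y)` is integrable on `Ω × ℝ^N`. -/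
  K_integrable : IntegrableOn
    (fun z => min 1 (‖z.1 - z.2‖ ^ p z) * K z) (Ω ×ˢ (univ : Set (EuclideanSpace ℝ (Fin N))))

namespace KernelSetting

variable {N : ℕ} (D : KernelSetting N)

/-- `Q = (ℝ^N × ℝ^N) \ (CΩ × CΩ)`. -/
def Q : Set (EuclideanSpace ℝ (Fin N) × EuclideanSpace ℝ (Fin N)) :=
  univ \ (D.Ωᶜ ×ˢ D.Ωᶜ)

/-- The modular `ρ(u) = ∫_Q |u(x) - u(y)|^{p(x, y)} K(x, y) dx dy`. -/
def modular (u : EuclideanSpace ℝ (Fin N) → ℝ) : ℝ≥0∞ :=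
  ∫⁻ z in D.Q, ENNReal.ofReal (|u z.1 - u z.2| ^ D.p z * D.K z)

/-- `[u] = inf {λ > 0 : ρ(u / λ) ≤ 1}`. -/
def gagliardo (u : EuclideanSpace ℝ (Fin N) → ℝ) : ℝ :=
  sInf {l : ℝ | 0 < l ∧ D.modular (fun x => u x / l) ≤ 1}

/-- Membership in the space `W^{K, p(x, y)}(Ω)`. -/
structure MemW (u : EuclideanSpace ℝ (Fin N) → ℝ) : Prop where
  /-- `u` is Lebesgue measurable. -/
  measurable : AEMeasurable u volume
  /-- `u` restricted to `Ω` is in `L^{p(x, x)}(Ω)`. -/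
  lebesgue : ∫⁻ x in D.Ω, ENNReal.ofReal (|u x| ^ D.p (x, x)) < ∞
  finite : ∃ l : ℝ, 0 < l ∧ D.modular (fun x => u x / l) < ∞

/-- Membership in the space `W₀^{K, p(x, y)}(Ω)`. -/
structure MemW₀ (u : EuclideanSpace ℝ (Fin N) → ℝ) : Prop extends D.MemW u where
  zero_outside : ∀ᵐ x, x ∉ D.Ω → u x = 0

/-! Elementary facts, which make `W₀^{K, p(x, y)}(Ω)` a normed space with norm `[·]`. -/

theorem modular_congr {u v : EuclideanSpace ℝ (Fin N) → ℝ} (h : u =ᵐ[volume] v) :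
    D.modular u = D.modular v := by
  refine lintegral_congr_ae (ae_restrict_of_ae ?_)
  have h1 := (Measure.quasiMeasurePreserving_fst
    (μ := (volume : Measure (EuclideanSpace ℝ (Fin N))))
    (ν := (volume : Measure (EuclideanSpace ℝ (Fin N))))).ae h
  have h2 := (Measure.quasiMeasurePreserving_snd
    (μ := (volume : Measure (EuclideanSpace ℝ (Fin N))))
    (ν := (volume : Measure (EuclideanSpace ℝ (Fin N))))).ae h
  rw [Measure.volume_eq_prod]
  filter_upwards [h1, h2] with z hz1 hz2
  rw [hz1, hz2]

theorem gagliardo_congr {u v : EuclideanSpace ℝ (Fin N) → ℝ} (h : u =ᵐ[volume] v) :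
    D.gagliardo u = D.gagliardo v := by
  unfold gagliardo
  congr 1
  ext l
  have : D.modular (fun x => u x / l) = D.modular (fun x => v x / l) :=
    D.modular_congr (by filter_upwards [h] with x hx; rw [hx])
  simp only [Set.mem_ofPred_eq, this]

theorem one_lt_p (z) : 1 < D.p z := by
  obtain ⟨a, ha, h⟩ := D.p_lower
  exact ha.trans_le (h z)

theorem aemeasurable_integrand {u : EuclideanSpace ℝ (Fin N) → ℝ} (hu : AEMeasurable u volume) :
    AEMeasurable (fun z : EuclideanSpace ℝ (Fin N) × EuclideanSpace ℝ (Fin N) =>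
      ENNReal.ofReal (|u z.1 - u z.2| ^ D.p z * D.K z)) volume := by
  have h1 : AEMeasurable (fun z : EuclideanSpace ℝ (Fin N) × EuclideanSpace ℝ (Fin N) => u z.1)
      volume := hu.comp_quasiMeasurePreserving Measure.quasiMeasurePreserving_fst
  have h2 : AEMeasurable (fun z : EuclideanSpace ℝ (Fin N) × EuclideanSpace ℝ (Fin N) => u z.2)
      volume := hu.comp_quasiMeasurePreserving Measure.quasiMeasurePreserving_snd
  have h3 : AEMeasurable (fun z : EuclideanSpace ℝ (Fin N) × EuclideanSpace ℝ (Fin N) =>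
      |u z.1 - u z.2|) volume := by
    simpa [Real.norm_eq_abs] using (h1.sub h2).norm
  exact ((h3.pow D.p_continuous.measurable.aemeasurable).mul D.K_measurable).ennreal_ofReal

theorem abs_rpow_convex {q a b : ℝ} (hq : 1 ≤ q) (ha : 0 ≤ a) (hb : 0 ≤ b) (hab : a + b = 1)
    (x y : ℝ) : |a * x + b * y| ^ q ≤ a * |x| ^ q + b * |y| ^ q := by
  have h1 : |a * x + b * y| ≤ a * |x| + b * |y| := by
    refine (abs_add_le _ _).trans (le_of_eq ?_)
    rw [abs_mul, abs_mul, abs_of_nonneg ha, abs_of_nonneg hb]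
  refine (Real.rpow_le_rpow (abs_nonneg _) h1 (by linarith)).trans ?_
  simpa using (convexOn_rpow hq).2 (abs_nonneg x) (abs_nonneg y) ha hb hab

theorem modular_convex {u v : EuclideanSpace ℝ (Fin N) → ℝ} (hu : AEMeasurable u volume)
    {a b : ℝ} (ha : 0 ≤ a) (hb : 0 ≤ b) (hab : a + b = 1) :
    D.modular (fun x => a * u x + b * v x) ≤
      ENNReal.ofReal a * D.modular u + ENNReal.ofReal b * D.modular v := by
  unfold modular
  rw [← lintegral_const_mul' _ _ ENNReal.ofReal_ne_top,
    ← lintegral_const_mul' _ _ ENNReal.ofReal_ne_top,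
    ← lintegral_add_left' ((D.aemeasurable_integrand hu).restrict.const_mul _)]
  refine lintegral_mono fun z => ?_
  rcases le_total (D.K z) 0 with hK | hK
  · have : |a * u z.1 + b * v z.1 - (a * u z.2 + b * v z.2)| ^ D.p z * D.K z ≤ 0 :=
      mul_nonpos_of_nonneg_of_nonpos (Real.rpow_nonneg (abs_nonneg _) _) hK
    simp only [ENNReal.ofReal_of_nonpos this, zero_le]
  · have h1 : 0 ≤ |u z.1 - u z.2| ^ D.p z := Real.rpow_nonneg (abs_nonneg _) _
    have h2 : 0 ≤ |v z.1 - v z.2| ^ D.p z := Real.rpow_nonneg (abs_nonneg _) _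
    rw [← ENNReal.ofReal_mul ha, ← ENNReal.ofReal_mul hb,
      ← ENNReal.ofReal_add (by positivity) (by positivity)]
    refine ENNReal.ofReal_le_ofReal ?_
    have h := abs_rpow_convex (D.one_lt_p z).le ha hb hab (u z.1 - u z.2) (v z.1 - v z.2)
    have h' : a * u z.1 + b * v z.1 - (a * u z.2 + b * v z.2)
        = a * (u z.1 - u z.2) + b * (v z.1 - v z.2) := by ring
    rw [h']
    calc _ ≤ (a * |u z.1 - u z.2| ^ D.p z + b * |v z.1 - v z.2| ^ D.p z) * D.K z :=
          mul_le_mul_of_nonneg_right h hK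
      _ = _ := by ring

theorem modular_zero : D.modular (fun _ => 0) = 0 := by
  unfold modular
  have : ∀ z, ENNReal.ofReal (|(0 : ℝ) - 0| ^ D.p z * D.K z) = 0 := fun z => by
    rw [sub_zero, abs_zero, Real.zero_rpow (by linarith [D.one_lt_p z]), zero_mul,
      ENNReal.ofReal_zero]
  simp only [this, lintegral_zero]

theorem modular_mul_le {u : EuclideanSpace ℝ (Fin N) → ℝ} (hu : AEMeasurable u volume)
    {a : ℝ} (ha : 0 ≤ a) (ha1 : a ≤ 1) :
    D.modular (fun x => a * u x) ≤ ENNReal.ofReal a * D.modular u := by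
  have h := D.modular_convex (v := fun _ => 0) hu ha (sub_nonneg.2 ha1) (by ring)
  simpa [D.modular_zero] using h

theorem modular_neg (u : EuclideanSpace ℝ (Fin N) → ℝ) :
    D.modular (fun x => -u x) = D.modular u := by
  unfold modular
  refine lintegral_congr fun z => ?_
  rw [← abs_neg]
  congr 4
  ring

/-- `|c|^{p}` is bounded. -/
theorem exists_rpow_le (c : ℝ) : ∃ C : ℝ, 0 ≤ C ∧ ∀ z, |c| ^ D.p z ≤ C := by
  obtain ⟨b, hb⟩ := D.p_upper
  refine ⟨max 1 |c| ^ b, by positivity, fun z => ?_⟩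
  calc |c| ^ D.p z ≤ max 1 |c| ^ D.p z :=
        Real.rpow_le_rpow (abs_nonneg _) (le_max_right _ _) (by linarith [D.one_lt_p z])
    _ ≤ max 1 |c| ^ b := Real.rpow_le_rpow_of_exponent_le (le_max_left _ _) (hb z)

theorem lebesgue_smul {u : EuclideanSpace ℝ (Fin N) → ℝ} (c : ℝ)
    (h : ∫⁻ x in D.Ω, ENNReal.ofReal (|u x| ^ D.p (x, x)) < ∞) :
    ∫⁻ x in D.Ω, ENNReal.ofReal (|c * u x| ^ D.p (x, x)) < ∞ := by
  obtain ⟨C, hC, hCb⟩ := D.exists_rpow_le c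
  calc ∫⁻ x in D.Ω, ENNReal.ofReal (|c * u x| ^ D.p (x, x))
      ≤ ∫⁻ x in D.Ω, ENNReal.ofReal C * ENNReal.ofReal (|u x| ^ D.p (x, x)) := by
        refine lintegral_mono fun x => ?_
        rw [← ENNReal.ofReal_mul hC, abs_mul, Real.mul_rpow (abs_nonneg _) (abs_nonneg _)]
        exact ENNReal.ofReal_le_ofReal
          (mul_le_mul_of_nonneg_right (hCb _) (Real.rpow_nonneg (abs_nonneg _) _))
    _ = ENNReal.ofReal C * ∫⁻ x in D.Ω, ENNReal.ofReal (|u x| ^ D.p (x, x)) :=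
        lintegral_const_mul' _ _ ENNReal.ofReal_ne_top
    _ < ∞ := ENNReal.mul_lt_top ENNReal.ofReal_lt_top h

theorem MemW₀.congr {u v : EuclideanSpace ℝ (Fin N) → ℝ} (hu : D.MemW₀ u)
    (h : u =ᵐ[volume] v) : D.MemW₀ v where
  measurable := hu.measurable.congr h
  lebesgue := by
    refine lt_of_eq_of_lt (lintegral_congr_ae (ae_restrict_of_ae ?_)) hu.lebesgue
    filter_upwards [h] with x hx
    rw [hx]
  finite := by
    obtain ⟨l, hl, hf⟩ := hu.finite
    refine ⟨l, hl, lt_of_eq_of_lt (D.modular_congr ?_) hf⟩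
    filter_upwards [h] with x hx
    rw [hx]
  zero_outside := by
    filter_upwards [h, hu.zero_outside] with x hx h0 hx'
    rw [← hx, h0 hx']

theorem memW₀_zero : D.MemW₀ (fun _ => 0) where
  measurable := aemeasurable_const
  lebesgue := by
    have : ∀ x, ENNReal.ofReal (|(0 : ℝ)| ^ D.p (x, x)) = 0 := fun x => by
      rw [abs_zero, Real.zero_rpow (by linarith [D.one_lt_p (x, x)]), ENNReal.ofReal_zero]
    simp only [this, lintegral_zero, ENNReal.zero_lt_top]
  finite := ⟨1, one_pos, by simp [D.modular_zero]⟩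
  zero_outside := by simp

theorem MemW₀.smul {u : EuclideanSpace ℝ (Fin N) → ℝ} (c : ℝ) (hu : D.MemW₀ u) :
    D.MemW₀ (fun x => c * u x) where
  measurable := hu.measurable.const_mul c
  lebesgue := D.lebesgue_smul c hu.lebesgue
  finite := by
    obtain ⟨l, hl, hf⟩ := hu.finite
    rcases lt_trichotomy c 0 with hc | hc | hc
    · refine ⟨-c * l, by nlinarith, ?_⟩
      have hne := hc.ne
      rw [← D.modular_neg]
      convert hf using 3 with x
      field_simp
    · subst hc
      exact ⟨1, one_pos, by simp [D.modular_zero]⟩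
    · refine ⟨c * l, by positivity, ?_⟩
      convert hf using 3 with x
      field_simp
  zero_outside := by
    filter_upwards [hu.zero_outside] with x h0 hx
    rw [h0 hx, mul_zero]

theorem MemW₀.add {u v : EuclideanSpace ℝ (Fin N) → ℝ} (hu : D.MemW₀ u) (hv : D.MemW₀ v) :
    D.MemW₀ (fun x => u x + v x) where
  measurable := hu.measurable.add hv.measurable
  lebesgue := by
    have h : ∫⁻ x in D.Ω, ENNReal.ofReal (|2⁻¹ * u x + 2⁻¹ * v x| ^ D.p (x, x)) < ∞ := by
      have hm : AEMeasurable (fun x => ENNReal.ofReal (|u x| ^ D.p (x, x)))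
          (volume.restrict D.Ω) := by
        have h1 : AEMeasurable (fun x => |u x|) volume := by
          simpa [Real.norm_eq_abs] using hu.measurable.norm
        have h2 : Continuous fun x : EuclideanSpace ℝ (Fin N) => D.p (x, x) :=
          D.p_continuous.comp (by fun_prop)
        exact (h1.pow h2.measurable.aemeasurable).ennreal_ofReal.restrict
      calc _ ≤ ∫⁻ x in D.Ω, (ENNReal.ofReal (|u x| ^ D.p (x, x))
              + ENNReal.ofReal (|v x| ^ D.p (x, x))) := by
            refine lintegral_mono fun x => ?_
            rw [← ENNReal.ofReal_add (Real.rpow_nonneg (abs_nonneg _) _)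
              (Real.rpow_nonneg (abs_nonneg _) _)]
            refine ENNReal.ofReal_le_ofReal ?_
            have h1 : 0 ≤ |u x| ^ D.p (x, x) := Real.rpow_nonneg (abs_nonneg _) _
            have h2 : 0 ≤ |v x| ^ D.p (x, x) := Real.rpow_nonneg (abs_nonneg _) _
            have := abs_rpow_convex (D.one_lt_p (x, x)).le (a := 2⁻¹) (b := 2⁻¹)
              (by norm_num) (by norm_num) (by norm_num) (u x) (v x)
            linarith
        _ = _ := lintegral_add_left' hm _
        _ < ∞ := ENNReal.add_lt_top.2 ⟨hu.lebesgue, hv.lebesgue⟩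
    have h2 := D.lebesgue_smul 2 h
    convert h2 using 6 with x
    ring
  finite := by
    obtain ⟨l, hl, hf⟩ := hu.finite
    obtain ⟨m, hm, hg⟩ := hv.finite
    refine ⟨l + m, by positivity, ?_⟩
    have h := D.modular_convex (u := fun x => u x / l) (v := fun x => v x / m)
      (a := l / (l + m)) (b := m / (l + m)) (hu.measurable.div_const l)
      (by positivity) (by positivity) (by field_simp)
    refine lt_of_le_of_lt (le_of_eq_of_le ?_ h) (ENNReal.add_lt_top.2
      ⟨ENNReal.mul_lt_top ENNReal.ofReal_lt_top hf, ENNReal.mul_lt_top ENNReal.ofReal_lt_top hg⟩)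
    congr 1
    ext x
    field_simp
  zero_outside := by
    filter_upwards [hu.zero_outside, hv.zero_outside] with x h0 h1 hx
    rw [h0 hx, h1 hx, add_zero]

theorem gagliardo_nonneg (u : EuclideanSpace ℝ (Fin N) → ℝ) : 0 ≤ D.gagliardo u :=
  Real.sInf_nonneg fun _ hl => hl.1.le

theorem gagliardo_le {u : EuclideanSpace ℝ (Fin N) → ℝ} {l : ℝ} (hl : 0 < l)
    (h : D.modular (fun x => u x / l) ≤ 1) : D.gagliardo u ≤ l :=
  csInf_le ⟨0, fun _ hm => hm.1.le⟩ ⟨hl, h⟩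

theorem MemW.nonempty {u : EuclideanSpace ℝ (Fin N) → ℝ} (hu : D.MemW u) :
    {l : ℝ | 0 < l ∧ D.modular (fun x => u x / l) ≤ 1}.Nonempty := by
  obtain ⟨l, hl, hf⟩ := hu.finite
  set M : ℝ := max (D.modular (fun x => u x / l)).toReal 1 with hM
  have hM1 : 1 ≤ M := le_max_right _ _
  have hM0 : 0 < M := by linarith
  refine ⟨M * l, by positivity, ?_⟩
  have h := D.modular_mul_le (u := fun x => u x / l) (a := M⁻¹) (hu.measurable.div_const l)
    (by positivity) (inv_le_one_of_one_le₀ hM1)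
  refine le_trans (le_of_eq_of_le ?_ h) ?_
  · congr 1
    ext x
    field_simp
  · rw [← ENNReal.ofReal_toReal hf.ne, ← ENNReal.ofReal_mul (by positivity),
      ← ENNReal.ofReal_one]
    refine ENNReal.ofReal_le_ofReal ?_
    rw [inv_mul_le_iff₀ hM0, mul_one]
    exact le_max_left _ _

theorem MemW.modular_le_one {u : EuclideanSpace ℝ (Fin N) → ℝ} (hu : D.MemW u) {l : ℝ}
    (hl : D.gagliardo u < l) : D.modular (fun x => u x / l) ≤ 1 := by
  obtain ⟨m, ⟨hm, hm1⟩, hml⟩ := exists_lt_of_csInf_lt (MemW.nonempty D hu) hl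
  have hl0 : 0 < l := hm.trans hml
  have h := D.modular_mul_le (u := fun x => u x / m) (a := m / l) (hu.measurable.div_const m)
    (by positivity) ((div_le_one hl0).2 hml.le)
  refine le_trans (le_of_eq_of_le ?_ h) ?_
  · congr 1
    ext x
    field_simp
  · exact mul_le_one' (ENNReal.ofReal_le_one.2 ((div_le_one hl0).2 hml.le)) hm1

theorem gagliardo_add_le {u v : EuclideanSpace ℝ (Fin N) → ℝ} (hu : D.MemW u) (hv : D.MemW v) :
    D.gagliardo (fun x => u x + v x) ≤ D.gagliardo u + D.gagliardo v := by
  refine le_of_forall_pos_le_add fun ε hε => ?_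
  set l := D.gagliardo u + ε / 2 with hl
  set m := D.gagliardo v + ε / 2 with hm
  have hl0 : 0 < l := by have := D.gagliardo_nonneg u; positivity
  have hm0 : 0 < m := by have := D.gagliardo_nonneg v; positivity
  have h1 : D.modular (fun x => u x / l) ≤ 1 :=
    MemW.modular_le_one D hu (by rw [hl]; linarith)
  have h2 : D.modular (fun x => v x / m) ≤ 1 :=
    MemW.modular_le_one D hv (by rw [hm]; linarith)
  have h := D.modular_convex (u := fun x => u x / l) (v := fun x => v x / m)
    (a := l / (l + m)) (b := m / (l + m)) (hu.measurable.div_const l)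
    (by positivity) (by positivity) (by field_simp)
  have key : D.gagliardo (fun x => u x + v x) ≤ l + m := by
    refine D.gagliardo_le (by positivity) (le_trans (le_of_eq_of_le ?_ h) ?_)
    · congr 1
      ext x
      field_simp
    · calc _ ≤ ENNReal.ofReal (l / (l + m)) * 1 + ENNReal.ofReal (m / (l + m)) * 1 := by gcongr
        _ = 1 := by
          rw [mul_one, mul_one, ← ENNReal.ofReal_add (by positivity) (by positivity),
            ← add_div, div_self (by positivity), ENNReal.ofReal_one]
  linarith

theorem gagliardo_zero : D.gagliardo (fun _ => 0) = 0 := by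
  refine le_antisymm (le_of_forall_pos_le_add fun ε hε => ?_) (D.gagliardo_nonneg _)
  rw [zero_add]
  exact D.gagliardo_le hε (by simp [D.modular_zero])

theorem gagliardo_mul_le {u : EuclideanSpace ℝ (Fin N) → ℝ} (hu : D.MemW u) {c : ℝ}
    (hc : c ≠ 0) : D.gagliardo (fun x => c * u x) ≤ |c| * D.gagliardo u := by
  have hc' : 0 < |c| := abs_pos.2 hc
  rw [← div_le_iff₀' hc']
  refine le_csInf (MemW.nonempty D hu) fun l hl => ?_
  rw [div_le_iff₀' hc']
  refine D.gagliardo_le (mul_pos hc' hl.1) (le_of_eq_of_le ?_ hl.2)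
  have hl0 := hl.1.ne'
  rcases lt_or_gt_of_ne hc with h | h
  · rw [abs_of_neg h, ← D.modular_neg]
    congr 1
    ext x
    field_simp
  · rw [abs_of_pos h]
    congr 1
    ext x
    field_simp

theorem gagliardo_mul {u : EuclideanSpace ℝ (Fin N) → ℝ} (hu : D.MemW₀ u) (c : ℝ) :
    D.gagliardo (fun x => c * u x) = |c| * D.gagliardo u := by
  rcases eq_or_ne c 0 with hc | hc
  · subst hc
    simp [D.gagliardo_zero]
  · refine le_antisymm (D.gagliardo_mul_le hu.toMemW hc) ?_
    have h := D.gagliardo_mul_le (MemW₀.smul D c hu).toMemW (inv_ne_zero hc)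
    have hc' : 0 < |c| := abs_pos.2 hc
    rw [abs_inv, ← div_eq_inv_mul, le_div_iff₀' hc'] at h
    simpa [inv_mul_cancel_left₀ hc] using h

theorem volume_compl_ne_zero : volume D.Ωᶜ ≠ 0 := by
  intro h
  have : Nonempty (Fin N) := ⟨⟨0, D.N_pos⟩⟩
  have h1 : volume D.Ω < ∞ := D.Ω_bounded.measure_lt_top
  have h2 : (volume : Measure (EuclideanSpace ℝ (Fin N))) univ ≤ volume D.Ω + volume D.Ωᶜ := by
    rw [← union_compl_self D.Ω]
    exact measure_union_le _ _
  rw [h, add_zero, measure_univ_of_isAddLeftInvariant] at h2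
  exact absurd h1 (not_lt.2 h2)

theorem ae_eq_zero_of_gagliardo {u : EuclideanSpace ℝ (Fin N) → ℝ} (hu : D.MemW₀ u)
    (h : D.gagliardo u = 0) : u =ᵐ[volume] fun _ => 0 := by
  have h0 : D.modular u = 0 := by
    refine le_antisymm (ENNReal.le_of_forall_pos_le_add fun ε hε _ => ?_) zero_le
    set l : ℝ := min ε 1 with hl
    have hl0 : 0 < l := lt_min (by exact_mod_cast hε) one_pos
    have h1 : D.modular (fun x => u x / l) ≤ 1 :=
      MemW.modular_le_one D hu.toMemW (by rw [h]; exact hl0)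
    have h2 := D.modular_mul_le (u := fun x => u x / l) (hu.measurable.div_const l) hl0.le
      (min_le_right _ _)
    have h3 : (fun x => l * (u x / l)) = u := by
      ext x
      field_simp
    rw [h3] at h2
    calc D.modular u ≤ ENNReal.ofReal l * 1 := h2.trans (by gcongr)
      _ ≤ 0 + ε := by
        rw [mul_one, zero_add, ← ENNReal.ofReal_coe_nnreal]
        exact ENNReal.ofReal_le_ofReal (min_le_left _ _)
  have hQ : MeasurableSet D.Q :=
    MeasurableSet.univ.diff (D.Ω_open.measurableSet.compl.prod D.Ω_open.measurableSet.compl)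
  unfold modular at h0
  rw [lintegral_eq_zero_iff' (D.aemeasurable_integrand hu.measurable).restrict] at h0
  have h1 := (ae_restrict_iff' hQ).1 h0
  rw [Measure.volume_eq_prod] at h1
  have h2 := Measure.ae_ae_of_ae_prod h1
  filter_upwards [h2, hu.zero_outside] with x hx hx0
  by_cases hxΩ : x ∈ D.Ω
  · have hfr : ∃ᵐ y ∂(volume : Measure (EuclideanSpace ℝ (Fin N))), y ∈ D.Ωᶜ :=
      frequently_ae_mem_iff.2 D.volume_compl_ne_zero
    obtain ⟨y, hy, hy1, hy0⟩ := (hfr.and_eventually (hx.and hu.zero_outside)).exists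
    have hz := hy1 ⟨mem_univ _, fun hm => hm.1 hxΩ⟩
    have hne : x ≠ y := fun e => hy (e ▸ hxΩ)
    have hK := D.K_pos x y hne
    simp only [Pi.zero_apply, ENNReal.ofReal_eq_zero, hy0 hy, sub_zero] at hz
    by_contra hux
    have : 0 < |u x| ^ D.p (x, y) * D.K (x, y) :=
      mul_pos (Real.rpow_pos_of_pos (abs_pos.2 hux) _) hK
    linarith
  · exact hx0 hxΩ

/-- `W₀^{K, p(x, y)}(Ω)` as a linear space of almost everywhere classes of functions. -/
def W₀submodule : Submodule ℝ (EuclideanSpace ℝ (Fin N) →ₘ[volume] ℝ) where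
  carrier := {u | D.MemW₀ u}
  add_mem' {u v} hu hv := MemW₀.congr D (MemW₀.add D hu hv) (AEEqFun.coeFn_add u v).symm
  zero_mem' := MemW₀.congr D D.memW₀_zero AEEqFun.coeFn_zero.symm
  smul_mem' c u hu := MemW₀.congr D (MemW₀.smul D c hu) (AEEqFun.coeFn_smul c u).symm

/-- The space `W₀^{K, p(x, y)}(Ω)`, with functions identified when they agree almost
everywhere. -/
def W₀ : Type := ↥D.W₀submodule

instance : AddCommGroup D.W₀ := inferInstanceAs (AddCommGroup ↥D.W₀submodule)

instance : Module ℝ D.W₀ := inferInstanceAs (Module ℝ ↥D.W₀submodule)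

/-- A representative of an element of `W₀^{K, p(x, y)}(Ω)`. -/
def W₀.fn {D : KernelSetting N} (u : D.W₀) : EuclideanSpace ℝ (Fin N) → ℝ :=
  (Subtype.val u : EuclideanSpace ℝ (Fin N) →ₘ[volume] ℝ)

/-- The norm of `W₀^{K, p(x, y)}(Ω)` is `[·]`. -/
instance : Norm D.W₀ := ⟨fun u => D.gagliardo u.fn⟩

theorem W₀.mem {D : KernelSetting N} (u : D.W₀) : D.MemW₀ u.fn := Subtype.property u

theorem W₀.fn_add {D : KernelSetting N} (u v : D.W₀) :
    (u + v).fn =ᵐ[volume] fun x => u.fn x + v.fn x :=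
  AEEqFun.coeFn_add (Subtype.val u) (Subtype.val v)

theorem W₀.fn_smul {D : KernelSetting N} (c : ℝ) (u : D.W₀) :
    (c • u).fn =ᵐ[volume] fun x => c * u.fn x :=
  AEEqFun.coeFn_smul c (Subtype.val u)

theorem W₀.fn_zero {D : KernelSetting N} : (0 : D.W₀).fn =ᵐ[volume] fun _ => 0 :=
  AEEqFun.coeFn_zero

theorem W₀.normCore : NormedSpace.Core ℝ D.W₀ where
  norm_nonneg u := D.gagliardo_nonneg u.fn
  norm_smul c u := (D.gagliardo_congr (W₀.fn_smul c u)).trans (D.gagliardo_mul u.mem c)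
  norm_triangle u v := (D.gagliardo_congr (W₀.fn_add u v)).trans_le
    (D.gagliardo_add_le u.mem.toMemW v.mem.toMemW)
  norm_eq_zero_iff u := by
    constructor
    · intro h
      have h1 := D.ae_eq_zero_of_gagliardo u.mem h
      exact Subtype.ext (AEEqFun.ext (h1.trans W₀.fn_zero.symm))
    · rintro rfl
      exact (D.gagliardo_congr W₀.fn_zero).trans D.gagliardo_zero

instance : NormedAddCommGroup D.W₀ := NormedAddCommGroup.ofCore (W₀.normCore D)

instance : NormedSpace ℝ D.W₀ := NormedSpace.ofCore (W₀.normCore D)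

/-- The integrand
`|u(x) - u(y)|^{p(x, y) - 2} (u(x) - u(y)) (φ(x) - φ(y)) K(x, y)`. -/
def integrand (u φ : EuclideanSpace ℝ (Fin N) → ℝ)
    (z : EuclideanSpace ℝ (Fin N) × EuclideanSpace ℝ (Fin N)) : ℝ :=
  |u z.1 - u z.2| ^ (D.p z - 2) * (u z.1 - u z.2) * (φ z.1 - φ z.2) * D.K z

end KernelSetting

end

/-! Everything rests on scalar inequalities for `|t|^q` and `|t|^(q-2) t` with constants uniform for
`q` in a compact part of `(1, ∞)`, integrated against `K`. Write `E(u)` for the energy `ρ(u)`,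
finite on all of `W₀` because `p` is bounded, and comparable with powers of the norm.

Quantitative monotonicity, `E(u - v) ≤ ε E(v) + C ⟨𝓛u - 𝓛v, u - v⟩` (`energy_sub_le`), gives strict
monotonicity and `(S₊)`. Since `⟨𝓛u, u⟩ = E(u)` grows superlinearly (`exists_mul_norm_le_energy`),
it also gives continuity of the inverse. Continuity of `𝓛` itself is `‖𝓛u - 𝓛v‖ ≤ ε (E(v) + 1) + C
E(u - v)` (`norm_operator_sub_le`).

Surjectivity is the direct method without weak compactness. The potential `J`, with density `|u(x) -
u(y)|^p K / p`, is uniformly convex on sets of bounded energy (`energy_sub_le_potential`), so a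
minimising sequence of `J - f` is Cauchy and its limit solves `𝓛v = f`.

Completeness comes from a Poincaré inequality into `L¹` and Fatou's lemma. The delicate point is
that the limit lies in `L^{p(x,x)}(Ω)`: the singularity of `K` yields a gain of integrability near
the diagonal, which absorbs the oscillation of `p` (`lintegral_rpow_lt_top`). -/

/-! ### Scalar inequalities, uniform in the exponent -/

theorem abs_rpow_sub_two_mul_abs {q : ℝ} (hq : 1 < q) (x : ℝ) :
    |x| ^ (q - 2) * |x| = |x| ^ (q - 1) := by
  rcases eq_or_ne x 0 with rfl | hx
  -- For `q < 2` the value given to `0 ^ (q - 2)` is immaterial: it is multiplied by zero.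
  · rw [abs_zero, mul_zero, Real.zero_rpow (by linarith)]
  · nth_rw 2 [← Real.rpow_one |x|]
    rw [← Real.rpow_add (abs_pos.2 hx)]
    congr 1
    ring

theorem abs_rpow_sub_one_mul_abs {q : ℝ} (hq : 1 < q) (x : ℝ) :
    |x| ^ (q - 1) * |x| = |x| ^ q := by
  rcases eq_or_ne x 0 with rfl | hx
  · rw [abs_zero, mul_zero, Real.zero_rpow (by linarith)]
  · nth_rw 2 [← Real.rpow_one |x|]
    rw [← Real.rpow_add (abs_pos.2 hx)]
    congr 1
    ring

theorem abs_signedPow {q : ℝ} (hq : 1 < q) (x : ℝ) :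
    |(|x| ^ (q - 2) * x)| = |x| ^ (q - 1) := by
  rw [abs_mul, abs_of_nonneg (Real.rpow_nonneg (abs_nonneg x) _), abs_rpow_sub_two_mul_abs hq]

theorem signedPow_mul_self {q : ℝ} (hq : 1 < q) (x : ℝ) :
    |x| ^ (q - 2) * x * x = |x| ^ q := by
  rw [mul_assoc, ← abs_mul_abs_self x, ← mul_assoc, abs_rpow_sub_two_mul_abs hq,
    abs_rpow_sub_one_mul_abs hq]

theorem abs_rpow_sub_one_mul_le {q : ℝ} (hq : 1 < q) (x y : ℝ) :
    |x| ^ (q - 1) * |y| ≤ |x| ^ q + |y| ^ q := by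
  rcases le_total |x| |y| with h | h
  · calc |x| ^ (q - 1) * |y| ≤ |y| ^ (q - 1) * |y| := by gcongr
      _ = |y| ^ q := abs_rpow_sub_one_mul_abs hq y
      _ ≤ _ := le_add_of_nonneg_left (Real.rpow_nonneg (abs_nonneg _) _)
  · calc |x| ^ (q - 1) * |y| ≤ |x| ^ (q - 1) * |x| := by gcongr
      _ = |x| ^ q := abs_rpow_sub_one_mul_abs hq x
      _ ≤ _ := le_add_of_nonneg_right (Real.rpow_nonneg (abs_nonneg _) _)

theorem abs_signedPow_mul_le {q : ℝ} (hq : 1 < q) (x y : ℝ) :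
    |(|x| ^ (q - 2) * x * y)| ≤ |x| ^ q + |y| ^ q := by
  rw [abs_mul, abs_signedPow hq]
  exact abs_rpow_sub_one_mul_le hq x y

/-- The graph of `|·|^q` lies above its tangents. -/
theorem abs_rpow_tangent {q : ℝ} (hq : 1 < q) (x y : ℝ) :
    |x| ^ q + q * (|x| ^ (q - 2) * x * (y - x)) ≤ |y| ^ q := by
  have hc := Real.HolderConjugate.conjExponent hq
  have h := Real.young_inequality_of_nonneg (abs_nonneg y)
    (Real.rpow_nonneg (abs_nonneg x) (q - 1)) hc
  have hq1 : q - 1 ≠ 0 := by linarith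
  have e1 : (|x| ^ (q - 1)) ^ q.conjExponent = |x| ^ q := by
    rw [← Real.rpow_mul (abs_nonneg x)]
    congr 1
    unfold Real.conjExponent
    field_simp
  have e2 : |x| ^ q / q.conjExponent * q = |x| ^ q * (q - 1) := by
    unfold Real.conjExponent
    have : q ≠ 0 := by linarith
    field_simp
  rw [e1] at h
  have h2 : |x| ^ (q - 2) * x * y ≤ |y| * |x| ^ (q - 1) := by
    refine (le_abs_self _).trans ?_
    rw [abs_mul, abs_signedPow hq, mul_comm]
  have h3 : q * (|x| ^ (q - 2) * x * y) ≤ |y| ^ q + |x| ^ q * (q - 1) := by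
    calc _ ≤ q * (|y| ^ q / q + |x| ^ q / q.conjExponent) := by
          gcongr
          exact h2.trans h
      _ = _ := by
          rw [mul_add, ← e2]
          have : q ≠ 0 := by linarith
          field_simp
  have h4 := signedPow_mul_self hq x
  nlinarith

theorem abs_add_rpow_le {q b : ℝ} (hq : 1 < q) (hb : q ≤ b) (x y : ℝ) :
    |x + y| ^ q ≤ 2 ^ b * (|x| ^ q + |y| ^ q) := by
  have h := KernelSetting.abs_rpow_convex hq.le (a := 2⁻¹) (b := 2⁻¹)
    (by norm_num) (by norm_num) (by norm_num) x y
  have e : |x + y| ^ q = 2 ^ q * |2⁻¹ * x + 2⁻¹ * y| ^ q := by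
    rw [← mul_add, abs_mul, Real.mul_rpow (abs_nonneg _) (abs_nonneg _),
      abs_of_pos (by norm_num : (0 : ℝ) < 2⁻¹), Real.inv_rpow (by norm_num)]
    have : (2 : ℝ) ^ q ≠ 0 := by positivity
    field_simp
  have h1 : 0 ≤ |x| ^ q := Real.rpow_nonneg (abs_nonneg _) _
  have h2 : 0 ≤ |y| ^ q := Real.rpow_nonneg (abs_nonneg _) _
  rw [e]
  have h3 : (2 : ℝ) ^ q ≤ 2 ^ b := Real.rpow_le_rpow_of_exponent_le (by norm_num) hb
  exact mul_le_mul h3 (by linarith) (Real.rpow_nonneg (abs_nonneg _) _) (by positivity)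

/-- Strict convexity of `t ^ q` on `[0, ∞)` settles `|x| ≠ |y|`; otherwise `x = -y` and the midpoint
is zero. -/
theorem abs_rpow_midpoint_lt {q : ℝ} (hq : 1 < q) {x y : ℝ} (hxy : x ≠ y) :
    0 < |x| ^ q + |y| ^ q - 2 * |(x + y) / 2| ^ q := by
  by_cases h : |x| = |y|
  · have hy : x = -y := (abs_eq_abs.1 h).resolve_left hxy
    have hy0 : y ≠ 0 := by rintro rfl; exact hxy (by simpa using hy)
    have : 0 < |y| ^ q := Real.rpow_pos_of_pos (abs_pos.2 hy0) _
    subst hy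
    simp only [neg_add_cancel, zero_div, abs_zero, abs_neg]
    rw [Real.zero_rpow (by linarith)]
    linarith
  · have h1 : (2⁻¹ * |x| + 2⁻¹ * |y|) ^ q < 2⁻¹ * |x| ^ q + 2⁻¹ * |y| ^ q :=
      (strictConvexOn_rpow hq).2 (mem_Ici.2 (abs_nonneg x)) (mem_Ici.2 (abs_nonneg y)) h
        (by norm_num : (0 : ℝ) < 2⁻¹) (by norm_num) (by norm_num)
    have h2 : |(x + y) / 2| ≤ 2⁻¹ * |x| + 2⁻¹ * |y| := by
      rw [abs_div, abs_of_pos (by norm_num : (0 : ℝ) < 2)]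
      linarith [abs_add_le x y]
    have h3 := Real.rpow_le_rpow (abs_nonneg _) h2 (by linarith : 0 ≤ q)
    linarith

theorem abs_rpow_midpoint_nonneg {q : ℝ} (hq : 1 < q) (x y : ℝ) :
    0 ≤ |x| ^ q + |y| ^ q - 2 * |(x + y) / 2| ^ q := by
  rcases eq_or_ne x y with rfl | h
  · rw [add_self_div_two]
    linarith
  · exact (abs_rpow_midpoint_lt hq h).le

/-- `|·|^q` is uniformly convex, uniformly for `q` in a compact subset of `(1, ∞)`. -/
theorem abs_rpow_uniformConvex {a b : ℝ} (ha : 1 < a) {ε : ℝ} (hε : 0 < ε) :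
    ∃ C : ℝ, 0 < C ∧ ∀ q ∈ Icc a b, ∀ x y : ℝ, |x - y| ^ q ≤
      ε * (|x| ^ q + |y| ^ q) + C * (|x| ^ q + |y| ^ q - 2 * |(x + y) / 2| ^ q) := by
  -- If `|x - y| < η (|x| + |y|)`, the `ε` term alone suffices, because `η ^ q ≤ η ≤ ε / 2 ^ b` and
  -- `(|x| + |y|) ^ q ≤ 2 ^ b (|x| ^ q + |y| ^ q)`.
  set η : ℝ := min 1 (ε / 2 ^ b) with hη
  have hη0 : 0 < η := lt_min one_pos (by positivity)
  have hη1 : η ≤ 1 := min_le_left _ _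
  -- In the other case homogeneity normalises `|x| + |y| = 1`. The exponent is part of the compact
  -- set, so the minimum `d` of the midpoint defect is positive uniformly in `q`.
  set S : Set (ℝ × ℝ × ℝ) :=
    {w | w.1 ∈ Icc a b ∧ |w.2.1| + |w.2.2| = 1 ∧ η ≤ |w.2.1 - w.2.2|} with hS
  have hSc : IsCompact S := by
    have h1 : IsCompact (Icc a b ×ˢ (Icc (-1 : ℝ) 1 ×ˢ Icc (-1 : ℝ) 1)) :=
      isCompact_Icc.prod (isCompact_Icc.prod isCompact_Icc)
    refine h1.of_isClosed_subset ?_ ?_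
    · refine IsClosed.inter (isClosed_Icc.preimage continuous_fst) (IsClosed.inter ?_ ?_)
      · exact isClosed_eq (f := fun w : ℝ × ℝ × ℝ => |w.2.1| + |w.2.2|) (g := fun _ => 1)
          (by fun_prop) (by fun_prop)
      · exact isClosed_le (f := fun _ => η) (g := fun w : ℝ × ℝ × ℝ => |w.2.1 - w.2.2|)
          (by fun_prop) (by fun_prop)
    · rintro ⟨q, x, y⟩ ⟨hq, hxy, -⟩
      simp only at hxy
      exact ⟨hq, abs_le.1 (by linarith [abs_nonneg y]), abs_le.1 (by linarith [abs_nonneg x])⟩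
  have hcont : ContinuousOn (fun w : ℝ × ℝ × ℝ =>
      |w.2.1| ^ w.1 + |w.2.2| ^ w.1 - 2 * |(w.2.1 + w.2.2) / 2| ^ w.1) S := by
    have key : ∀ f : ℝ × ℝ × ℝ → ℝ, Continuous f → ContinuousOn (fun w => f w ^ w.1) S :=
      fun f hf => hf.continuousOn.rpow continuous_fst.continuousOn
        fun w hw => Or.inr (by have := hw.1.1; linarith)
    exact ((key _ (by fun_prop)).add (key _ (by fun_prop))).sub
      (continuousOn_const.mul (key _ (by fun_prop)))
  obtain ⟨d, hd, hdS⟩ : ∃ d : ℝ, 0 < d ∧ ∀ w ∈ S,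
      d ≤ |w.2.1| ^ w.1 + |w.2.2| ^ w.1 - 2 * |(w.2.1 + w.2.2) / 2| ^ w.1 := by
    refine hSc.exists_forall_le' hcont (a := 0) ?_
    rintro ⟨q, x, y⟩ ⟨hq, hxy, hη'⟩
    refine abs_rpow_midpoint_lt (ha.trans_le hq.1) ?_
    intro hxy'
    simp only at hxy' hη'
    rw [hxy', sub_self, abs_zero] at hη'
    linarith
  refine ⟨d⁻¹, by positivity, fun q hq x y => ?_⟩
  have hq1 : 1 < q := ha.trans_le hq.1
  have hmid := abs_rpow_midpoint_nonneg hq1 x y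
  have hx0 : 0 ≤ |x| ^ q := Real.rpow_nonneg (abs_nonneg _) _
  have hy0 : 0 ≤ |y| ^ q := Real.rpow_nonneg (abs_nonneg _) _
  set s := |x| + |y| with hs
  have hs0 : 0 ≤ s := by positivity
  by_cases h : η * s ≤ |x - y|
  · rcases hs0.eq_or_lt with h0 | hspos
    · have hx : x = 0 := abs_eq_zero.1 (by linarith [abs_nonneg x, abs_nonneg y])
      have hy : y = 0 := abs_eq_zero.1 (by linarith [abs_nonneg x, abs_nonneg y])
      subst hx hy
      rw [sub_zero, abs_zero, Real.zero_rpow (by linarith)] at *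
      positivity
    · have hsc : ∀ t : ℝ, |t / s| ^ q = |t| ^ q / s ^ q := fun t => by
        rw [abs_div, abs_of_pos hspos, Real.div_rpow (abs_nonneg _) hs0]
      have hsq : 0 < s ^ q := Real.rpow_pos_of_pos hspos _
      have h1 := hdS (q, x / s, y / s) ⟨hq, by
        simp only [abs_div, abs_of_pos hspos]
        rw [← add_div, ← hs, div_self hspos.ne'], by
        simp only
        rw [← sub_div, abs_div, abs_of_pos hspos, le_div_iff₀ hspos]
        exact h⟩
      simp only at h1
      rw [← add_div, div_right_comm, hsc, hsc, hsc, ← add_div, ← mul_div_assoc, ← sub_div,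
        le_div_iff₀ hsq] at h1
      have h2 : |x - y| ^ q ≤ s ^ q :=
        Real.rpow_le_rpow (abs_nonneg _) (abs_sub x y) (by linarith)
      have h3 : s ^ q ≤ d⁻¹ * (|x| ^ q + |y| ^ q - 2 * |(x + y) / 2| ^ q) := by
        rw [← div_eq_inv_mul, le_div_iff₀ hd]
        linarith
      have : 0 ≤ ε * (|x| ^ q + |y| ^ q) := by positivity
      linarith
  · push Not at h
    have h1 : |x - y| ^ q ≤ (η * s) ^ q := Real.rpow_le_rpow (abs_nonneg _) h.le (by linarith)
    have h2 : η ^ q ≤ ε / 2 ^ b := by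
      refine le_trans ?_ (min_le_right 1 _)
      rw [← hη]
      simpa using Real.rpow_le_rpow_of_exponent_ge hη0 hη1 hq1.le
    have h3 : s ^ q ≤ 2 ^ b * (|x| ^ q + |y| ^ q) := by
      have := abs_add_rpow_le hq1 hq.2 |x| |y|
      rwa [abs_abs, abs_abs, abs_of_nonneg hs0] at this
    rw [Real.mul_rpow hη0.le hs0] at h1
    have h4 : η ^ q * s ^ q ≤ ε / 2 ^ b * (2 ^ b * (|x| ^ q + |y| ^ q)) :=
      mul_le_mul h2 h3 (Real.rpow_nonneg hs0 _) (by positivity)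
    have h5 : ε / 2 ^ b * (2 ^ b * (|x| ^ q + |y| ^ q)) = ε * (|x| ^ q + |y| ^ q) := by
      have : (2 : ℝ) ^ b ≠ 0 := by positivity
      field_simp
    have : 0 ≤ d⁻¹ * (|x| ^ q + |y| ^ q - 2 * |(x + y) / 2| ^ q) := by positivity
    linarith

/-- Sum of the tangent inequalities at `x` and at `y`, both evaluated at the midpoint. It converts
uniform convexity into monotonicity. -/
theorem signedPow_monotone {q : ℝ} (hq : 1 < q) (x y : ℝ) :
    |x| ^ q + |y| ^ q - 2 * |(x + y) / 2| ^ q ≤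
      q / 2 * ((|x| ^ (q - 2) * x - |y| ^ (q - 2) * y) * (x - y)) := by
  have h1 := abs_rpow_tangent hq x ((x + y) / 2)
  have h2 := abs_rpow_tangent hq y ((x + y) / 2)
  linarith

/-- Quantitative monotonicity of `x ↦ |x|^{q-2} x`. -/
theorem abs_sub_rpow_le_monotone {a b : ℝ} (ha : 1 < a) {ε : ℝ} (hε : 0 < ε) :
    ∃ C : ℝ, 0 < C ∧ ∀ q ∈ Icc a b, ∀ x y : ℝ, |x - y| ^ q ≤
      ε * |y| ^ q + C * ((|x| ^ (q - 2) * x - |y| ^ (q - 2) * y) * (x - y)) := by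
  have h2b : (0 : ℝ) < 2 ^ b := by positivity
  -- After `|x| ^ q ≤ 2 ^ b (|x - y| ^ q + |y| ^ q)`, the first bound lets half of `|x - y| ^ q` be
  -- absorbed on the left; the second leaves `ε / 2` in front of `|y| ^ q`.
  set δ : ℝ := min (1 / (2 * 2 ^ b)) (ε / (2 * (2 ^ b + 1))) with hδ
  have hδ0 : 0 < δ := lt_min (by positivity) (by positivity)
  obtain ⟨C, hC, h⟩ := abs_rpow_uniformConvex (b := b) ha hδ0
  refine ⟨C * (|b| + 1), by positivity, fun q hq x y => ?_⟩
  have hq1 : 1 < q := ha.trans_le hq.1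
  have h1 := h q hq x y
  have h2 := signedPow_monotone hq1 x y
  have h3 := abs_add_rpow_le hq1 hq.2 (x - y) y
  rw [sub_add_cancel] at h3
  set M := (|x| ^ (q - 2) * x - |y| ^ (q - 2) * y) * (x - y) with hM
  have hmid := abs_rpow_midpoint_nonneg hq1 x y
  have hM0 : 0 ≤ M := by
    by_contra hneg
    have : q / 2 * M < 0 := mul_neg_of_pos_of_neg (by linarith) (not_le.1 hneg)
    linarith
  have hd1 : δ * 2 ^ b ≤ 1 / 2 := by
    have := min_le_left (1 / (2 * 2 ^ b)) (ε / (2 * (2 ^ b + 1)))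
    rw [← hδ, le_div_iff₀ (by positivity)] at this
    linarith
  have hd2 : δ * (2 ^ b + 1) ≤ ε / 2 := by
    have := min_le_right (1 / (2 * 2 ^ b)) (ε / (2 * (2 ^ b + 1)))
    rw [← hδ, le_div_iff₀ (by positivity)] at this
    linarith
  have hx0 : 0 ≤ |x - y| ^ q := Real.rpow_nonneg (abs_nonneg _) _
  have hy0 : 0 ≤ |y| ^ q := Real.rpow_nonneg (abs_nonneg _) _
  have e1 : δ * (|x| ^ q + |y| ^ q) ≤ 1 / 2 * |x - y| ^ q + ε / 2 * |y| ^ q := by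
    calc δ * (|x| ^ q + |y| ^ q) ≤ δ * (2 ^ b * (|x - y| ^ q + |y| ^ q) + |y| ^ q) := by gcongr
      _ = δ * 2 ^ b * |x - y| ^ q + δ * (2 ^ b + 1) * |y| ^ q := by ring
      _ ≤ _ := by gcongr
  have e2 : C * (|x| ^ q + |y| ^ q - 2 * |(x + y) / 2| ^ q) ≤ C * ((|b| + 1) / 2 * M) := by
    refine mul_le_mul_of_nonneg_left (h2.trans ?_) hC.le
    gcongr
    linarith [hq.2, le_abs_self b]
  linarith

/-- Split at `|y| = t |x|`, with `t ≥ 1` so large that `t ^ (-(a - 1)) ≤ ε`. Larger exponents only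
improve this, so `C = t` serves every `q ≥ a`. -/
theorem abs_rpow_sub_one_mul_le_eps {a : ℝ} (ha : 1 < a) {ε : ℝ} (hε : 0 < ε) :
    ∃ C : ℝ, 0 < C ∧ ∀ q, a ≤ q → ∀ x y : ℝ,
      |x| ^ (q - 1) * |y| ≤ ε * |y| ^ q + C * |x| ^ q := by
  obtain ⟨t, ht1, ht⟩ : ∃ t : ℝ, 1 ≤ t ∧ t ^ (-(a - 1)) ≤ ε := by
    have h := tendsto_rpow_neg_atTop (y := a - 1) (by linarith)
    obtain ⟨t, h1, h2⟩ := ((eventually_ge_atTop 1).and (h.eventually_le_const hε)).exists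
    exact ⟨t, h1, h2⟩
  have ht0 : 0 < t := by linarith
  refine ⟨t, ht0, fun q hq x y => ?_⟩
  have hq1 : 1 < q := ha.trans_le hq
  have hx0 : 0 ≤ |x| ^ q := Real.rpow_nonneg (abs_nonneg _) _
  have hy0 : 0 ≤ |y| ^ q := Real.rpow_nonneg (abs_nonneg _) _
  rcases le_total |y| (t * |x|) with h | h
  · calc |x| ^ (q - 1) * |y| ≤ |x| ^ (q - 1) * (t * |x|) := by gcongr
      _ = t * |x| ^ q := by rw [← abs_rpow_sub_one_mul_abs hq1 x]; ring
      _ ≤ _ := le_add_of_nonneg_left (by positivity)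
  · have h' : |x| ≤ t⁻¹ * |y| := by rwa [← div_eq_inv_mul, le_div_iff₀' ht0]
    calc |x| ^ (q - 1) * |y| ≤ (t⁻¹ * |y|) ^ (q - 1) * |y| := by
          gcongr
      _ = t ^ (-(q - 1)) * |y| ^ q := by
          rw [Real.mul_rpow (by positivity) (abs_nonneg _), Real.inv_rpow ht0.le,
            Real.rpow_neg ht0.le, mul_assoc, abs_rpow_sub_one_mul_abs hq1]
      _ ≤ ε * |y| ^ q := by
          gcongr
          exact (Real.rpow_le_rpow_of_exponent_le ht1 (by linarith)).trans ht
      _ ≤ _ := le_add_of_nonneg_right (by positivity)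

/-- Near `1`, `x ^ (q - 1)` lies between `1` and `x ^ (b - 1)`, so continuity at the single exponent
`b - 1` covers all `q`. Away from `1`, both `|x|` and `1` are at most a multiple of `|x - 1|`. -/
theorem abs_signedPow_sub_one_le {a b : ℝ} (ha : 1 < a) {ε : ℝ} (hε : 0 < ε) :
    ∃ C : ℝ, 1 ≤ C ∧ ∀ q ∈ Icc a b, ∀ x : ℝ,
      |(|x| ^ (q - 2) * x - 1)| ≤ ε + C * |x - 1| ^ (q - 1) := by
  obtain ⟨δ, hδ, h⟩ : ∃ δ > 0, ∀ x : ℝ, |x - 1| < δ → |x ^ (b - 1) - 1| < ε := by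
    have := Real.continuousAt_rpow_const (1 : ℝ) (b - 1) (Or.inl one_ne_zero)
    simpa [Real.dist_eq] using Metric.continuousAt_iff.1 this ε hε
  set η := min δ 1 with hη
  have hη0 : 0 < η := lt_min hδ one_pos
  have hη1 : η ≤ 1 := min_le_right _ _
  have hone : 1 ≤ 1 + 1 / η := by have : 0 < 1 / η := by positivity
                                  linarith
  refine ⟨2 * (1 + 1 / η) ^ (|b|), ?_, fun q hq x => ?_⟩
  · have := Real.one_le_rpow hone (abs_nonneg b)
    linarith
  have hq1 : 1 < q := ha.trans_le hq.1
  rcases lt_or_ge |x - 1| η with hx | hx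
  · have hx0 : 0 < x := by
      have := (abs_lt.1 (hx.trans_le hη1)).1
      linarith
    have e : |x| ^ (q - 2) * x = x ^ (q - 1) := by
      have := abs_rpow_sub_two_mul_abs hq1 x
      rwa [abs_of_pos hx0] at this ⊢
    have h1 := h x (hx.trans_le (min_le_left _ _))
    rw [e]
    refine le_trans ?_ (le_add_of_nonneg_right (by positivity))
    rcases le_total 1 x with h1x | hx1
    · have h2 : x ^ (q - 1) ≤ x ^ (b - 1) :=
        Real.rpow_le_rpow_of_exponent_le h1x (by linarith [hq.2])
      have h3 : 1 ≤ x ^ (q - 1) := Real.one_le_rpow h1x (by linarith)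
      rw [abs_of_nonneg (by linarith)] at h1 ⊢
      linarith
    · have h2 : x ^ (b - 1) ≤ x ^ (q - 1) :=
        Real.rpow_le_rpow_of_exponent_ge hx0 hx1 (by linarith [hq.2])
      have h3 : x ^ (q - 1) ≤ 1 := Real.rpow_le_one hx0.le hx1 (by linarith)
      rw [abs_of_nonpos (by linarith)] at h1 ⊢
      linarith
  · have h1 : |x| ≤ (1 + 1 / η) * |x - 1| := by
      have h2 : 1 ≤ 1 / η * |x - 1| := by
        rw [one_div, ← div_eq_inv_mul, le_div_iff₀ hη0]
        linarith
      have h3 : |x| ≤ |x - 1| + 1 := by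
        have := abs_add_le (x - 1) 1
        simpa using this
      linarith
    have h2 : 1 ≤ (1 + 1 / η) * |x - 1| := by
      have h2 : 1 ≤ 1 / η * |x - 1| := by
        rw [one_div, ← div_eq_inv_mul, le_div_iff₀ hη0]
        linarith
      linarith [abs_nonneg (x - 1)]
    have h3 : |x| ^ (q - 1) ≤ ((1 + 1 / η) * |x - 1|) ^ (q - 1) :=
      Real.rpow_le_rpow (abs_nonneg _) h1 (by linarith)
    have h4 : 1 ≤ ((1 + 1 / η) * |x - 1|) ^ (q - 1) := Real.one_le_rpow h2 (by linarith)
    have h5 : ((1 + 1 / η) * |x - 1|) ^ (q - 1) ≤ (1 + 1 / η) ^ |b| * |x - 1| ^ (q - 1) := by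
      rw [Real.mul_rpow (by linarith) (abs_nonneg _)]
      gcongr
      linarith [hq.2, le_abs_self b]
    have h6 : |(|x| ^ (q - 2) * x - 1)| ≤ |x| ^ (q - 1) + 1 := by
      have := abs_sub (|x| ^ (q - 2) * x) 1
      rwa [abs_signedPow hq1, abs_one] at this
    linarith

/-- Homogeneity of degree `q - 1` reduces this to `y = 1`; the case `y = 0` is why `C ≥ 1` is
recorded. -/
theorem abs_signedPow_sub_le {a b : ℝ} (ha : 1 < a) {ε : ℝ} (hε : 0 < ε) :
    ∃ C : ℝ, 1 ≤ C ∧ ∀ q ∈ Icc a b, ∀ x y : ℝ,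
      |(|x| ^ (q - 2) * x - |y| ^ (q - 2) * y)| ≤
        ε * |y| ^ (q - 1) + C * |x - y| ^ (q - 1) := by
  obtain ⟨C, hC, h⟩ := abs_signedPow_sub_one_le (b := b) ha hε
  refine ⟨C, hC, fun q hq x y => ?_⟩
  have hq1 : 1 < q := ha.trans_le hq.1
  rcases eq_or_ne y 0 with rfl | hy
  · rw [mul_zero, sub_zero, sub_zero, abs_signedPow hq1]
    have : 0 ≤ |x| ^ (q - 1) := Real.rpow_nonneg (abs_nonneg _) _
    have h0 : 0 ≤ ε * |(0 : ℝ)| ^ (q - 1) := by positivity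
    nlinarith
  · have h1 := h q hq (x / y)
    have hy' : 0 < |y| := abs_pos.2 hy
    have hyq : 0 < |y| ^ (q - 1) := Real.rpow_pos_of_pos hy' _
    have e1 : |(|x| ^ (q - 2) * x - |y| ^ (q - 2) * y)| =
        |y| ^ (q - 1) * |(|x / y| ^ (q - 2) * (x / y) - 1)| := by
      rw [← abs_rpow_sub_two_mul_abs hq1 y, ← abs_of_nonneg (Real.rpow_nonneg hy'.le (q - 2)),
        ← abs_mul, ← abs_mul, abs_div, Real.div_rpow (abs_nonneg _) hy'.le]
      rw [abs_of_nonneg (Real.rpow_nonneg hy'.le (q - 2))]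
      congr 1
      have : |y| ^ (q - 2) ≠ 0 := (Real.rpow_pos_of_pos hy' _).ne'
      field_simp
    have e2 : |x - y| ^ (q - 1) = |y| ^ (q - 1) * |x / y - 1| ^ (q - 1) := by
      rw [← Real.mul_rpow hy'.le (abs_nonneg _), ← abs_mul]
      congr 2
      field_simp
    rw [e1, e2]
    calc _ ≤ |y| ^ (q - 1) * (ε + C * |x / y - 1| ^ (q - 1)) := by gcongr
      _ = _ := by ring

/-- Quantitative continuity of `x ↦ |x|^{q-2} x`. -/
theorem abs_signedPow_sub_mul_le {a b : ℝ} (ha : 1 < a) {ε : ℝ} (hε : 0 < ε) :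
    ∃ C : ℝ, 0 < C ∧ ∀ q ∈ Icc a b, ∀ x y w : ℝ,
      |(|x| ^ (q - 2) * x - |y| ^ (q - 2) * y) * w| ≤
        ε * (|y| ^ q + |w| ^ q) + C * |x - y| ^ q := by
  obtain ⟨C, hC, h⟩ := abs_signedPow_sub_le (b := b) ha (half_pos hε)
  have hC0 : 0 < C := by linarith
  obtain ⟨C', hC', h'⟩ := abs_rpow_sub_one_mul_le_eps ha (div_pos (half_pos hε) hC0)
  refine ⟨C * C', by positivity, fun q hq x y w => ?_⟩
  have hq1 : 1 < q := ha.trans_le hq.1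
  have h1 := abs_rpow_sub_one_mul_le hq1 y w
  have h2 := h' q hq.1 (x - y) w
  have hy0 : 0 ≤ |y| ^ q := Real.rpow_nonneg (abs_nonneg _) _
  rw [abs_mul]
  calc _ ≤ (ε / 2 * |y| ^ (q - 1) + C * |x - y| ^ (q - 1)) * |w| := by
        gcongr
        exact h q hq x y
    _ = ε / 2 * (|y| ^ (q - 1) * |w|) + C * (|x - y| ^ (q - 1) * |w|) := by ring
    _ ≤ ε / 2 * (|y| ^ q + |w| ^ q) + C * (ε / 2 / C * |w| ^ q + C' * |x - y| ^ q) := by gcongr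
    _ = ε / 2 * |y| ^ q + ε * |w| ^ q + C * C' * |x - y| ^ q := by field_simp; ring
    _ ≤ _ := by
      have : 0 ≤ ε / 2 * |y| ^ q := by positivity
      linarith

/-! ### The energy and its comparison with the Luxemburg norm -/

namespace KernelSetting

variable {N : ℕ} (D : KernelSetting N)

/-- A lower bound of the exponent which is larger than one. -/
noncomputable def pMin : ℝ := D.p_lower.choose

/-- An upper bound of the exponent. -/
noncomputable def pMax : ℝ := D.p_upper.choose

theorem one_lt_pMin : 1 < D.pMin := D.p_lower.choose_spec.1

theorem p_mem_Icc (z) : D.p z ∈ Icc D.pMin D.pMax :=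
  ⟨D.p_lower.choose_spec.2 z, D.p_upper.choose_spec z⟩

theorem one_lt_pMax : 1 < D.pMax :=
  D.one_lt_pMin.trans_le ((D.p_mem_Icc 0).1.trans (D.p_mem_Icc 0).2)

theorem ae_prod_and {P : EuclideanSpace ℝ (Fin N) → Prop} (h : ∀ᵐ x, P x) :
    ∀ᵐ z : EuclideanSpace ℝ (Fin N) × EuclideanSpace ℝ (Fin N), P z.1 ∧ P z.2 :=
  (Measure.quasiMeasurePreserving_fst.ae h).and (Measure.quasiMeasurePreserving_snd.ae h)

/-- The diagonal is null because Lebesgue measure has no atoms when `N ≥ 1`. -/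
theorem ae_K_pos : ∀ᵐ z, 0 < D.K z := by
  have : Nonempty (Fin N) := ⟨⟨0, D.N_pos⟩⟩
  have h : ∀ᵐ z : EuclideanSpace ℝ (Fin N) × EuclideanSpace ℝ (Fin N), z.1 ≠ z.2 := by
    refine (Measure.ae_prod_iff_ae_ae
      (measurableSet_eq_fun measurable_fst measurable_snd).compl).2 (Eventually.of_forall fun x => ?_)
    filter_upwards [(volume : Measure (EuclideanSpace ℝ (Fin N))).ae_ne x] with y hy using hy.symm
  filter_upwards [h] with z hz using D.K_pos z.1 z.2 hz

theorem measurableSet_Q : MeasurableSet D.Q :=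
  MeasurableSet.univ.diff (D.Ω_open.measurableSet.compl.prod D.Ω_open.measurableSet.compl)

/-- Off `Q` both points lie outside `Ω`, where the difference vanishes; this reconciles the modular
over `Q` with the operator's integral over the whole space. -/
theorem modular_eq_lintegral {u : EuclideanSpace ℝ (Fin N) → ℝ}
    (hu : ∀ᵐ x, x ∉ D.Ω → u x = 0) :
    D.modular u = ∫⁻ z, ENNReal.ofReal (|u z.1 - u z.2| ^ D.p z * D.K z) := by
  unfold modular
  rw [← lintegral_indicator D.measurableSet_Q]
  refine lintegral_congr_ae ?_
  filter_upwards [ae_prod_and hu] with z hz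
  by_cases hQ : z ∈ D.Q
  · rw [indicator_of_mem hQ]
  · have h : z.1 ∉ D.Ω ∧ z.2 ∉ D.Ω := by
      by_contra hne
      exact hQ ⟨mem_univ _, fun h => hne ⟨h.1, h.2⟩⟩
    rw [indicator_of_notMem hQ, hz.1 h.1, hz.2 h.2, sub_zero, abs_zero,
      Real.zero_rpow (by linarith [D.one_lt_p z]), zero_mul, ENNReal.ofReal_zero]

theorem modular_mul_lt_top {u : EuclideanSpace ℝ (Fin N) → ℝ} (c : ℝ)
    (h : D.modular u < ∞) : D.modular (fun x => c * u x) < ∞ := by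
  obtain ⟨C, hC, hCb⟩ := D.exists_rpow_le c
  refine lt_of_le_of_lt ?_ (ENNReal.mul_lt_top (ENNReal.ofReal_lt_top (r := C)) h)
  unfold modular
  rw [← lintegral_const_mul' _ _ ENNReal.ofReal_ne_top]
  refine lintegral_mono_ae ?_
  filter_upwards [ae_restrict_of_ae D.ae_K_pos] with z hz
  rw [← ENNReal.ofReal_mul hC, ← mul_sub, abs_mul, Real.mul_rpow (abs_nonneg _) (abs_nonneg _),
    ← mul_assoc]
  refine ENNReal.ofReal_le_ofReal (mul_le_mul_of_nonneg_right ?_ hz.le)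
  exact mul_le_mul_of_nonneg_right (hCb _) (Real.rpow_nonneg (abs_nonneg _) _)

/-- As `p` is bounded, finiteness at one scale `l` passes to scale `1`, so the energy can be handled
as a Bochner integral. -/
theorem MemW₀.modular_lt_top {u : EuclideanSpace ℝ (Fin N) → ℝ} (hu : D.MemW₀ u) :
    D.modular u < ∞ := by
  obtain ⟨l, hl, h⟩ := hu.finite
  refine lt_of_eq_of_lt ?_ (D.modular_mul_lt_top l h)
  congr 1
  ext x
  field_simp

namespace W₀

variable {D}

/-- The difference `u(x) - u(y)`. -/
noncomputable def diff (u : D.W₀) (z : EuclideanSpace ℝ (Fin N) × EuclideanSpace ℝ (Fin N)) : ℝ :=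
  u.fn z.1 - u.fn z.2

/-- The integral of `|u(x) - u(y)|^{p(x, y)} K(x, y)`. -/
noncomputable def energy (u : D.W₀) : ℝ := ∫ z, |u.diff z| ^ D.p z * D.K z

theorem diff_add (u v : D.W₀) : ∀ᵐ z, (u + v).diff z = u.diff z + v.diff z := by
  filter_upwards [ae_prod_and (fn_add u v)] with z hz
  simp only [diff, hz.1, hz.2]
  ring

theorem diff_smul (c : ℝ) (u : D.W₀) : ∀ᵐ z, (c • u).diff z = c * u.diff z := by
  filter_upwards [ae_prod_and (fn_smul c u)] with z hz
  simp only [diff, hz.1, hz.2]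
  ring

theorem diff_sub (u v : D.W₀) : ∀ᵐ z, (u - v).diff z = u.diff z - v.diff z := by
  have h : u - v = u + (-1 : ℝ) • v := by rw [neg_one_smul, sub_eq_add_neg]
  rw [h]
  filter_upwards [diff_add u ((-1 : ℝ) • v), diff_smul (-1) v] with z h1 h2
  rw [h1, h2]
  ring

theorem aemeasurable_diff (u : D.W₀) : AEMeasurable u.diff volume :=
  (u.mem.measurable.comp_quasiMeasurePreserving Measure.quasiMeasurePreserving_fst).sub
    (u.mem.measurable.comp_quasiMeasurePreserving Measure.quasiMeasurePreserving_snd)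

theorem energy_integrand_nonneg (u : D.W₀) : ∀ᵐ z, 0 ≤ |u.diff z| ^ D.p z * D.K z := by
  filter_upwards [D.ae_K_pos] with z hz
  exact mul_nonneg (Real.rpow_nonneg (abs_nonneg _) _) hz.le

theorem integrable_energy (u : D.W₀) :
    Integrable (fun z => |u.diff z| ^ D.p z * D.K z) volume := by
  have hm : AEMeasurable (fun z => |u.diff z| ^ D.p z * D.K z) volume :=
    ((u.aemeasurable_diff.norm).pow D.p_continuous.measurable.aemeasurable).mul D.K_measurable
  refine ⟨hm.aestronglyMeasurable, ?_⟩
  rw [hasFiniteIntegral_iff_ofReal u.energy_integrand_nonneg]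
  have h := u.mem.modular_lt_top
  rwa [D.modular_eq_lintegral u.mem.zero_outside] at h

theorem energy_nonneg (u : D.W₀) : 0 ≤ u.energy :=
  integral_nonneg_of_ae u.energy_integrand_nonneg

theorem modular_eq_energy (u : D.W₀) : D.modular u.fn = ENNReal.ofReal u.energy := by
  rw [D.modular_eq_lintegral u.mem.zero_outside, energy,
    ofReal_integral_eq_lintegral_ofReal u.integrable_energy u.energy_integrand_nonneg]
  rfl

theorem modular_div (u : D.W₀) (l : ℝ) :
    D.modular (fun x => u.fn x / l) = ENNReal.ofReal (l⁻¹ • u).energy := by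
  rw [← modular_eq_energy]
  refine D.modular_congr ?_
  filter_upwards [fn_smul l⁻¹ u] with x hx
  rw [hx, div_eq_inv_mul]

theorem norm_le_of_energy_le_one {u : D.W₀} {l : ℝ} (hl : 0 < l)
    (h : (l⁻¹ • u).energy ≤ 1) : ‖u‖ ≤ l :=
  D.gagliardo_le hl (by rw [modular_div]; exact ENNReal.ofReal_le_one.2 h)

theorem energy_le_one_of_norm_lt {u : D.W₀} {l : ℝ} (h : ‖u‖ < l) :
    (l⁻¹ • u).energy ≤ 1 := by
  have := MemW.modular_le_one D u.mem.toMemW h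
  rwa [modular_div, ENNReal.ofReal_le_one] at this

/-- A variable exponent destroys homogeneity; what remains are scaling bounds with `pMax` for
factors above `1` and `pMin` for factors below `1`. -/
theorem energy_smul_le {u : D.W₀} {c e : ℝ} (h : ∀ z, |c| ^ D.p z ≤ e) :
    (c • u).energy ≤ e * u.energy := by
  unfold energy
  rw [← integral_const_mul]
  refine integral_mono_ae (integrable_energy _) (u.integrable_energy.const_mul _) ?_
  filter_upwards [diff_smul c u, D.ae_K_pos] with z hz hK
  rw [hz, abs_mul, Real.mul_rpow (abs_nonneg _) (abs_nonneg _), mul_assoc]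
  exact mul_le_mul_of_nonneg_right (h z)
    (mul_nonneg (Real.rpow_nonneg (abs_nonneg _) _) hK.le)

theorem energy_smul_le_of_one_le {u : D.W₀} {c : ℝ} (hc : 1 ≤ c) :
    (c • u).energy ≤ c ^ D.pMax * u.energy :=
  energy_smul_le fun z => by
    rw [abs_of_nonneg (by linarith)]
    exact Real.rpow_le_rpow_of_exponent_le hc (D.p_mem_Icc z).2

theorem energy_smul_le_of_le_one {u : D.W₀} {c : ℝ} (hc0 : 0 < c) (hc : c ≤ 1) :
    (c • u).energy ≤ c ^ D.pMin * u.energy :=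
  energy_smul_le fun z => by
    rw [abs_of_pos hc0]
    exact Real.rpow_le_rpow_of_exponent_ge hc0 hc (D.p_mem_Icc z).1

theorem energy_le_of_norm_lt_of_one_le {u : D.W₀} {l : ℝ} (hl : 1 ≤ l) (h : ‖u‖ < l) :
    u.energy ≤ l ^ D.pMax := by
  have h1 := energy_le_one_of_norm_lt h
  have h2 := energy_smul_le_of_one_le (u := l⁻¹ • u) hl
  rw [smul_inv_smul₀ (by linarith)] at h2
  exact h2.trans (mul_le_of_le_one_right (by positivity) h1)

theorem energy_le_of_norm_lt_of_le_one {u : D.W₀} {l : ℝ} (hl : l ≤ 1) (h : ‖u‖ < l) :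
    u.energy ≤ l := by
  have hl0 : 0 < l := (norm_nonneg u).trans_lt h
  have h1 := energy_le_one_of_norm_lt h
  have h2 := energy_smul_le_of_le_one (u := l⁻¹ • u) hl0 hl
  rw [smul_inv_smul₀ hl0.ne'] at h2
  refine h2.trans ((mul_le_of_le_one_right (by positivity) h1).trans ?_)
  simpa using Real.rpow_le_rpow_of_exponent_ge hl0 hl D.one_lt_pMin.le

theorem norm_le_of_energy_le {u : D.W₀} {l : ℝ} (hl0 : 0 < l) (hl : l ≤ 1)
    (h : u.energy ≤ l ^ D.pMax) : ‖u‖ ≤ l := by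
  refine norm_le_of_energy_le_one hl0 ((energy_smul_le_of_one_le ((one_le_inv₀ hl0).2 hl)).trans ?_)
  rw [Real.inv_rpow hl0.le, inv_mul_le_iff₀ (by positivity), mul_one]
  exact h

/-- The energy of `u / l` exceeds `1`, and shrinking by `l⁻¹ ≤ 1` multiplies the energy by at most
`l ^ (-pMin)`. With `pMin > 1` this is the source of coercivity. -/
theorem rpow_le_energy {u : D.W₀} {l : ℝ} (hl : 1 ≤ l) (h : l < ‖u‖) :
    l ^ D.pMin ≤ u.energy := by
  have hl0 : 0 < l := by linarith
  have h1 : 1 < (l⁻¹ • u).energy := by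
    by_contra hne
    exact absurd (norm_le_of_energy_le_one hl0 (not_lt.1 hne)) (not_le.2 h)
  have h2 := energy_smul_le_of_le_one (u := u) (inv_pos.2 hl0) (inv_le_one_of_one_le₀ hl)
  rw [Real.inv_rpow hl0.le] at h2
  have h3 := h1.trans_le h2
  rw [← div_eq_inv_mul, one_lt_div (by positivity)] at h3
  exact h3.le

theorem eq_zero_of_energy_nonpos {u : D.W₀} (h : u.energy ≤ 0) : u = 0 := by
  refine norm_le_zero_iff.1 (le_of_forall_pos_le_add fun ε hε => ?_)
  rw [zero_add]
  have hm : 0 < min ε 1 := lt_min hε one_pos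
  exact (norm_le_of_energy_le hm (min_le_right _ _) (h.trans (by positivity))).trans
    (min_le_left _ _)

end W₀

end KernelSetting

/-! ### The operator: boundedness, monotonicity, continuity, coercivity -/

namespace KernelSetting

variable {N : ℕ} {D : KernelSetting N}

namespace W₀

theorem integrable_integrand (u φ : D.W₀) : Integrable (D.integrand u.fn φ.fn) volume := by
  have hp : AEMeasurable D.p volume := D.p_continuous.measurable.aemeasurable
  have hm : AEMeasurable (D.integrand u.fn φ.fn) volume :=
    ((((u.aemeasurable_diff.norm).pow (hp.sub_const 2)).mul u.aemeasurable_diff).mul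
      φ.aemeasurable_diff).mul D.K_measurable
  refine (u.integrable_energy.add φ.integrable_energy).mono' hm.aestronglyMeasurable ?_
  filter_upwards [D.ae_K_pos] with z hz
  rw [integrand, Real.norm_eq_abs, abs_mul, abs_of_pos hz]
  refine (mul_le_mul_of_nonneg_right (abs_signedPow_mul_le (D.one_lt_p z) _ _) hz.le).trans_eq ?_
  rw [add_mul]
  rfl

/-- The pairing `⟨𝓛(u), φ⟩`. -/
noncomputable def form (u φ : D.W₀) : ℝ := ∫ z, D.integrand u.fn φ.fn z

theorem integrand_eq (u φ : D.W₀) (z) : D.integrand u.fn φ.fn z =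
    |u.diff z| ^ (D.p z - 2) * u.diff z * φ.diff z * D.K z := rfl

theorem form_add (u φ ψ : D.W₀) : form u (φ + ψ) = form u φ + form u ψ := by
  unfold form
  rw [← integral_add (integrable_integrand u φ) (integrable_integrand u ψ)]
  refine integral_congr_ae ?_
  filter_upwards [diff_add φ ψ] with z hz
  simp only [integrand_eq, hz]
  ring

theorem form_smul (u φ : D.W₀) (c : ℝ) : form u (c • φ) = c * form u φ := by
  unfold form
  rw [← integral_const_mul]
  refine integral_congr_ae ?_
  filter_upwards [diff_smul c φ] with z hz
  simp only [integrand_eq, hz]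
  ring

theorem abs_form_le (u φ : D.W₀) : |form u φ| ≤ u.energy + φ.energy := by
  unfold form energy
  rw [← integral_add u.integrable_energy φ.integrable_energy]
  refine (abs_integral_le_integral_abs).trans (integral_mono_ae (integrable_integrand u φ).abs
    (u.integrable_energy.add φ.integrable_energy) ?_)
  filter_upwards [D.ae_K_pos] with z hz
  rw [integrand_eq, abs_mul, abs_of_pos hz]
  refine (mul_le_mul_of_nonneg_right (abs_signedPow_mul_le (D.one_lt_p z) _ _) hz.le).trans_eq ?_
  rw [add_mul]

theorem form_self (u : D.W₀) : form u u = u.energy := by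
  refine integral_congr_ae (Eventually.of_forall fun z => ?_)
  simp only [integrand_eq, signedPow_mul_self (D.one_lt_p z)]

/-- Bounds on the unit energy set are operator bounds: `φ / l` has energy at most `1` for every `l >
‖φ‖`, and then `l` tends to `‖φ‖`. -/
theorem norm_le_mul_norm {F : Type*} [NormedAddCommGroup F] [NormedSpace ℝ F]
    (f : D.W₀ →ₗ[ℝ] F) {C : ℝ} (hC : 0 ≤ C)
    (h : ∀ φ : D.W₀, φ.energy ≤ 1 → ‖f φ‖ ≤ C) (φ : D.W₀) : ‖f φ‖ ≤ C * ‖φ‖ := by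
  refine le_of_forall_pos_le_add fun ε hε => ?_
  set l := ‖φ‖ + ε / (C + 1) with hl
  have hε' : 0 < ε / (C + 1) := by positivity
  have hl0 : 0 < l := by positivity
  have h1 := h _ (energy_le_one_of_norm_lt (u := φ) (l := l) (by linarith))
  rw [map_smul, norm_smul, norm_inv, Real.norm_of_nonneg hl0.le, inv_mul_le_iff₀ hl0] at h1
  have h2 : C * (ε / (C + 1)) ≤ ε := by
    rw [← mul_div_assoc, div_le_iff₀ (by positivity)]
    nlinarith
  nlinarith

/-- The operator `𝓛`. -/
noncomputable def operator (u : D.W₀) : StrongDual ℝ D.W₀ :=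
  LinearMap.mkContinuous
    { toFun := form u
      map_add' := form_add u
      map_smul' := fun c φ => form_smul u φ c } (u.energy + 1) fun φ => by
    have := u.energy_nonneg
    refine norm_le_mul_norm _ (by linarith) (fun ψ hψ => ?_) φ
    exact (abs_form_le u ψ).trans (by linarith)

theorem operator_apply (u φ : D.W₀) : operator u φ = form u φ := rfl

theorem norm_operator_le (u : D.W₀) : ‖operator u‖ ≤ u.energy + 1 :=
  LinearMap.mkContinuous_norm_le _ (by linarith [u.energy_nonneg]) _

theorem operator_sub_apply (u v φ : D.W₀) : (operator u - operator v) φ =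
    ∫ z, (|u.diff z| ^ (D.p z - 2) * u.diff z - |v.diff z| ^ (D.p z - 2) * v.diff z) *
      φ.diff z * D.K z := by
  rw [_root_.sub_apply, operator_apply, operator_apply, form, form,
    ← integral_sub (integrable_integrand u φ) (integrable_integrand v φ)]
  refine integral_congr_ae (Eventually.of_forall fun z => ?_)
  simp only [integrand_eq]
  ring

theorem integrable_operator_sub (u v φ : D.W₀) : Integrable (fun z =>
    (|u.diff z| ^ (D.p z - 2) * u.diff z - |v.diff z| ^ (D.p z - 2) * v.diff z) *
      φ.diff z * D.K z) volume := by
  refine ((integrable_integrand u φ).sub (integrable_integrand v φ)).congr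
    (Eventually.of_forall fun z => ?_)
  simp only [Pi.sub_apply, integrand_eq]
  ring

theorem energy_sub (u v : D.W₀) :
    (u - v).energy = ∫ z, |u.diff z - v.diff z| ^ D.p z * D.K z := by
  refine integral_congr_ae ?_
  filter_upwards [diff_sub u v] with z hz
  rw [hz]

theorem integrable_energy_sub (u v : D.W₀) :
    Integrable (fun z => |u.diff z - v.diff z| ^ D.p z * D.K z) volume := by
  refine (u - v).integrable_energy.congr ?_
  filter_upwards [diff_sub u v] with z hz
  rw [hz]

/-- Quantitative strict monotonicity of the operator. -/
theorem energy_sub_le (D : KernelSetting N) {ε : ℝ} (hε : 0 < ε) :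
    ∃ C : ℝ, 0 < C ∧ ∀ u v : D.W₀,
      (u - v).energy ≤ ε * v.energy + C * (operator u - operator v) (u - v) := by
  obtain ⟨C, hC, h⟩ := abs_sub_rpow_le_monotone (b := D.pMax) D.one_lt_pMin hε
  refine ⟨C, hC, fun u v => ?_⟩
  have hI := integrable_operator_sub u v (u - v)
  rw [energy_sub, operator_sub_apply, energy, ← integral_const_mul, ← integral_const_mul,
    ← integral_add (v.integrable_energy.const_mul ε) (hI.const_mul C)]
  refine integral_mono_ae (integrable_energy_sub u v)
    ((v.integrable_energy.const_mul ε).add (hI.const_mul C)) ?_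
  filter_upwards [diff_sub u v, D.ae_K_pos] with z hz hK
  simp only [hz]
  refine (mul_le_mul_of_nonneg_right (h _ (D.p_mem_Icc z) (u.diff z) (v.diff z)) hK.le).trans_eq ?_
  ring

/-- Quantitative continuity of the operator. -/
theorem norm_operator_sub_le (D : KernelSetting N) {ε : ℝ} (hε : 0 < ε) :
    ∃ C : ℝ, 0 < C ∧ ∀ u v : D.W₀,
      ‖operator u - operator v‖ ≤ ε * (v.energy + 1) + C * (u - v).energy := by
  obtain ⟨C, hC, h⟩ := abs_signedPow_sub_mul_le (b := D.pMax) D.one_lt_pMin hε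
  refine ⟨C, hC, fun u v => ?_⟩
  have h0 : 0 ≤ ε * (v.energy + 1) + C * (u - v).energy := by
    have := v.energy_nonneg
    have := (u - v).energy_nonneg
    positivity
  refine ContinuousLinearMap.opNorm_le_bound _ h0 fun φ => ?_
  refine norm_le_mul_norm (operator u - operator v).toLinearMap h0 (fun ψ hψ => ?_) φ
  have hI := integrable_operator_sub u v ψ
  have hJ := integrable_energy_sub u v
  have hE : Integrable (fun z => ε * (|v.diff z| ^ D.p z * D.K z + |ψ.diff z| ^ D.p z * D.K z))
      volume := (v.integrable_energy.add ψ.integrable_energy).const_mul ε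
  have key : |(operator u - operator v) ψ| ≤ ε * (v.energy + ψ.energy) + C * (u - v).energy := by
    rw [energy_sub, operator_sub_apply, energy, energy,
      ← integral_add v.integrable_energy ψ.integrable_energy,
      ← integral_const_mul, ← integral_const_mul,
      ← integral_add hE (hJ.const_mul C)]
    refine abs_integral_le_integral_abs.trans (integral_mono_ae hI.abs
      (hE.add (hJ.const_mul C)) ?_)
    filter_upwards [D.ae_K_pos] with z hK
    rw [abs_mul, abs_of_pos hK]
    refine (mul_le_mul_of_nonneg_right
      (h _ (D.p_mem_Icc z) (u.diff z) (v.diff z) (ψ.diff z)) hK.le).trans_eq ?_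
    ring
  refine key.trans ?_
  gcongr

theorem exists_energy_le_of_norm_le (D : KernelSetting N) {ε : ℝ} (hε : 0 < ε) :
    ∃ δ : ℝ, 0 < δ ∧ ∀ u : D.W₀, u.energy ≤ δ → ‖u‖ < ε := by
  have hm : 0 < min (ε / 2) 1 := lt_min (half_pos hε) one_pos
  refine ⟨min (ε / 2) 1 ^ D.pMax, by positivity, fun u hu => ?_⟩
  exact (norm_le_of_energy_le hm (min_le_right _ _) hu).trans_lt
    ((min_le_left _ _).trans_lt (half_lt_self hε))

/-- The energy grows superlinearly. -/
theorem exists_mul_norm_le_energy (D : KernelSetting N) (M : ℝ) :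
    ∃ R : ℝ, 2 ≤ R ∧ ∀ u : D.W₀, R < ‖u‖ → M * ‖u‖ ≤ u.energy := by
  have h := tendsto_rpow_atTop (y := D.pMin - 1) (by linarith [D.one_lt_pMin])
  obtain ⟨R, hR⟩ := eventually_atTop.1 (h.eventually_ge_atTop (2 * M))
  -- The energy bound needs `1 ≤ l < ‖u‖`, so it is used at `l = ‖u‖ / 2`; the threshold `2 * M`
  -- above pays for the half.
  refine ⟨max 2 (2 * R), le_max_left _ _, fun u hu => ?_⟩
  have h2 : 2 < ‖u‖ := (le_max_left _ _).trans_lt hu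
  have h3 : 2 * R < ‖u‖ := (le_max_right _ _).trans_lt hu
  have h4 := hR (‖u‖ / 2) (by linarith)
  have h5 : (‖u‖ / 2) ^ D.pMin ≤ u.energy := rpow_le_energy (by linarith) (by linarith)
  refine le_trans ?_ h5
  have h6 : (‖u‖ / 2) ^ D.pMin = (‖u‖ / 2) ^ (D.pMin - 1) * (‖u‖ / 2) := by
    have := abs_rpow_sub_one_mul_abs D.one_lt_pMin (‖u‖ / 2)
    rwa [abs_of_pos (by linarith : 0 < ‖u‖ / 2), eq_comm] at this
  rw [h6]
  nlinarith

theorem operator_monotone {u v : D.W₀} (h : u ≠ v) :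
    0 < (operator u - operator v) (u - v) := by
  have hpos : 0 < (u - v).energy := by
    by_contra hne
    exact h (sub_eq_zero.1 (eq_zero_of_energy_nonpos (not_lt.1 hne)))
  have hv := v.energy_nonneg
  -- With this `ε` the term `ε E(v)` is at most half of `E(u - v)`, so the pairing must account for
  -- the rest.
  obtain ⟨C, hC, hCuv⟩ := energy_sub_le D
    (show 0 < (u - v).energy / (2 * (v.energy + 1)) by positivity)
  have h1 := hCuv u v
  have h2 : (u - v).energy / (2 * (v.energy + 1)) * v.energy ≤ (u - v).energy / 2 := by
    rw [div_mul_eq_mul_div, div_le_div_iff₀ (by positivity) two_pos]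
    nlinarith
  by_contra hne
  have := mul_nonpos_of_nonneg_of_nonpos hC.le (not_lt.1 hne)
  linarith

theorem operator_injective : Function.Injective (operator (D := D)) := by
  intro u v h
  by_contra hne
  have := operator_monotone hne
  rw [h, sub_self] at this
  simp at this

theorem operator_continuous : Continuous (operator (D := D)) := by
  refine continuous_iff_continuousAt.2 fun v => Metric.continuousAt_iff.2 fun ε hε => ?_
  have hv := v.energy_nonneg
  obtain ⟨C, hC, h⟩ := norm_operator_sub_le D
    (show 0 < ε / (2 * (v.energy + 1)) by positivity)
  refine ⟨min 1 (ε / (4 * C)), lt_min one_pos (by positivity), fun u hu => ?_⟩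
  rw [dist_eq_norm] at hu ⊢
  have h1 := energy_le_of_norm_lt_of_le_one (min_le_left _ _) hu
  have h2 : C * (u - v).energy ≤ ε / 4 := by
    calc _ ≤ C * (ε / (4 * C)) := by gcongr; exact h1.trans (min_le_right _ _)
      _ = ε / 4 := by field_simp
  have h3 : ε / (2 * (v.energy + 1)) * (v.energy + 1) = ε / 2 := by field_simp
  have := h u v
  linarith

/-- Convergence of the monotone pairing to zero forces strong convergence. -/
theorem exists_norm_sub_lt_of_pairing (v : D.W₀) {ε : ℝ} (hε : 0 < ε) :
    ∃ δ : ℝ, 0 < δ ∧ ∀ u : D.W₀, (operator u - operator v) (u - v) < δ → ‖u - v‖ < ε := by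
  obtain ⟨η, hη, h⟩ := exists_energy_le_of_norm_le D hε
  have hv := v.energy_nonneg
  obtain ⟨C, hC, hCuv⟩ := energy_sub_le D (show 0 < η / (2 * (v.energy + 1)) by positivity)
  refine ⟨η / (2 * C), by positivity, fun u hu => h _ ((hCuv u v).trans ?_)⟩
  have h2 : η / (2 * (v.energy + 1)) * v.energy ≤ η / 2 := by
    rw [div_mul_eq_mul_div, div_le_div_iff₀ (by positivity) two_pos]
    nlinarith
  have h3 : C * (operator u - operator v) (u - v) ≤ η / 2 := by
    calc _ ≤ C * (η / (2 * C)) := by gcongr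
      _ = η / 2 := by field_simp
  linarith

/-- Continuity of the inverse at `𝓛v`. The pairing is at most `‖𝓛u - 𝓛v‖ ‖u - v‖`, so it is small
once `‖u - v‖` is bounded a priori. That bound holds because `‖𝓛u - 𝓛v‖ ≤ 1` gives `E(u - v) ≤ E(v)
+ C ‖u - v‖`, against superlinear growth. -/
theorem exists_norm_sub_lt_of_operator (v : D.W₀) {ε : ℝ} (hε : 0 < ε) :
    ∃ δ : ℝ, 0 < δ ∧ ∀ u : D.W₀, ‖operator u - operator v‖ < δ → ‖u - v‖ < ε := by
  have hv := v.energy_nonneg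
  obtain ⟨C, hC, hCuv⟩ := energy_sub_le D one_pos
  obtain ⟨R, hR, hRu⟩ := exists_mul_norm_le_energy D (v.energy + C + 1)
  obtain ⟨δ, hδ, hδu⟩ := exists_norm_sub_lt_of_pairing v hε
  refine ⟨min 1 (δ / (R + 1)), lt_min one_pos (by positivity), fun u hu => hδu u ?_⟩
  have h1 : (operator u - operator v) (u - v) ≤ ‖operator u - operator v‖ * ‖u - v‖ :=
    (le_abs_self _).trans ((operator u - operator v).le_opNorm _)
  have hn := norm_nonneg (u - v)
  have hbound : ‖u - v‖ ≤ R := by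
    by_contra hne
    have hlt := not_le.1 hne
    have h2 := hRu _ hlt
    have h3 := hCuv u v
    have h4 : ‖operator u - operator v‖ * ‖u - v‖ ≤ 1 * ‖u - v‖ := by
      gcongr
      exact hu.le.trans (min_le_left _ _)
    have h5 : C * (operator u - operator v) (u - v) ≤ C * ‖u - v‖ := by
      gcongr
      linarith
    nlinarith
  calc _ ≤ ‖operator u - operator v‖ * ‖u - v‖ := h1
    _ ≤ min 1 (δ / (R + 1)) * R := by gcongr
    _ ≤ δ / (R + 1) * R := by gcongr; exact min_le_right _ _
    _ < δ := by
      rw [div_mul_eq_mul_div, div_lt_iff₀ (by positivity)]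
      nlinarith

theorem operator_bounded {B : Set D.W₀} (hB : Bornology.IsBounded B) :
    Bornology.IsBounded (operator '' B) := by
  obtain ⟨R, hR⟩ := hB.exists_norm_le
  refine (Metric.isBounded_closedBall (x := 0) (r := (|R| + 1) ^ D.pMax + 1)).subset ?_
  rintro _ ⟨u, hu, rfl⟩
  rw [mem_closedBall_zero_iff]
  refine (norm_operator_le u).trans ?_
  gcongr
  have := hR u hu
  exact energy_le_of_norm_lt_of_one_le (by linarith [abs_nonneg R]) (by linarith [le_abs_self R])

theorem operator_coercive :
    Tendsto (fun u : D.W₀ => operator u u / ‖u‖) (Bornology.cobounded D.W₀) atTop := by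
  refine tendsto_atTop.2 fun M => ?_
  obtain ⟨R, hR, h⟩ := exists_mul_norm_le_energy D M
  filter_upwards [tendsto_norm_cobounded_atTop.eventually (eventually_gt_atTop R)] with u hu
  rw [le_div_iff₀ (by linarith), operator_apply, form_self]
  exact h u hu

theorem tendsto_of_limsup_pairing_le {u : ℕ → D.W₀} {v : D.W₀}
    (h : limsup (fun k => (((operator (u k) - operator v) (u k - v) : ℝ) : EReal)) atTop ≤ 0) :
    Tendsto u atTop (𝓝 v) := by
  refine Metric.tendsto_nhds.2 fun ε hε => ?_
  obtain ⟨δ, hδ, hu⟩ := exists_norm_sub_lt_of_pairing v hε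
  have hδ' : (0 : EReal) < (δ : EReal) := by exact_mod_cast hδ
  filter_upwards [eventually_lt_of_limsup_lt (h.trans_lt hδ')] with k hk
  rw [dist_eq_norm]
  exact hu _ (by exact_mod_cast hk)

/-! ### The potential, surjectivity and the homeomorphism -/

/-- The potential `∫ |u(x) - u(y)|^{p(x, y)} / p(x, y) K(x, y)` of the operator. -/
noncomputable def potential (u : D.W₀) : ℝ := ∫ z, |u.diff z| ^ D.p z / D.p z * D.K z

theorem integrable_potential (u : D.W₀) :
    Integrable (fun z => |u.diff z| ^ D.p z / D.p z * D.K z) volume := by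
  have hp : AEMeasurable D.p volume := D.p_continuous.measurable.aemeasurable
  have hm : AEMeasurable (fun z => |u.diff z| ^ D.p z / D.p z * D.K z) volume :=
    (((u.aemeasurable_diff.norm).pow hp).div hp).mul D.K_measurable
  refine u.integrable_energy.mono' hm.aestronglyMeasurable ?_
  filter_upwards [D.ae_K_pos] with z hz
  have h1 := D.one_lt_p z
  have h2 : 0 ≤ |u.diff z| ^ D.p z := Real.rpow_nonneg (abs_nonneg _) _
  rw [Real.norm_eq_abs, abs_of_nonneg (by positivity)]
  gcongr
  exact div_le_self h2 h1.le

theorem energy_le_potential (u : D.W₀) : u.energy ≤ D.pMax * u.potential := by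
  unfold energy potential
  rw [← integral_const_mul]
  refine integral_mono_ae u.integrable_energy (u.integrable_potential.const_mul _) ?_
  filter_upwards [D.ae_K_pos] with z hz
  have h1 := D.one_lt_p z
  have h2 : 0 ≤ |u.diff z| ^ D.p z := Real.rpow_nonneg (abs_nonneg _) _
  rw [← mul_assoc]
  gcongr
  rw [← mul_div_assoc, le_div_iff₀ (by linarith), mul_comm]
  gcongr
  exact (D.p_mem_Icc z).2

/-- Pointwise tangent inequality divided by `p`: `𝓛u` is a subgradient of the potential. It supplies
both lower semicontinuity and the Euler equation, so no differentiability is needed. -/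
theorem potential_tangent (u v : D.W₀) :
    u.potential + operator u (v - u) ≤ v.potential := by
  rw [operator_apply, form, potential, potential,
    ← integral_add u.integrable_potential (integrable_integrand u _)]
  refine integral_mono_ae (u.integrable_potential.add (integrable_integrand u _))
    v.integrable_potential ?_
  filter_upwards [D.ae_K_pos, diff_sub v u] with z hz hd
  have h1 := D.one_lt_p z
  have h2 := abs_rpow_tangent h1 (u.diff z) (v.diff z)
  rw [integrand_eq, hd, ← add_mul]
  refine mul_le_mul_of_nonneg_right ?_ hz.le
  rw [div_add' _ _ _ (by linarith), div_le_div_iff_of_pos_right (by linarith)]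
  linarith

/-- The potential is uniformly convex on sets of bounded energy. -/
theorem energy_sub_le_potential (D : KernelSetting N) {ε : ℝ} (hε : 0 < ε) :
    ∃ C : ℝ, 0 < C ∧ ∀ u v : D.W₀, (u - v).energy ≤ ε * (u.energy + v.energy) +
      C * (u.potential + v.potential - 2 * ((2⁻¹ : ℝ) • (u + v)).potential) := by
  obtain ⟨C, hC, h⟩ := abs_rpow_uniformConvex (b := D.pMax) D.one_lt_pMin hε
  -- The midpoint defect is nonnegative, so removing the weight `1 / p` costs at most a factor
  -- `pMax`.
  refine ⟨C * D.pMax, mul_pos hC (by linarith [D.one_lt_pMax]), fun u v => ?_⟩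
  set w := (2⁻¹ : ℝ) • (u + v) with hw
  have hI : Integrable (fun z => ε * (|u.diff z| ^ D.p z * D.K z + |v.diff z| ^ D.p z * D.K z))
      volume := (u.integrable_energy.add v.integrable_energy).const_mul ε
  have hS : Integrable (fun z => |u.diff z| ^ D.p z / D.p z * D.K z +
      |v.diff z| ^ D.p z / D.p z * D.K z) volume :=
    u.integrable_potential.add v.integrable_potential
  have hJ : Integrable (fun z => C * D.pMax * (|u.diff z| ^ D.p z / D.p z * D.K z +
      |v.diff z| ^ D.p z / D.p z * D.K z - 2 * (|w.diff z| ^ D.p z / D.p z * D.K z))) volume :=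
    (hS.sub (w.integrable_potential.const_mul 2)).const_mul (C * D.pMax)
  have e1 : ε * (u.energy + v.energy) =
      ∫ z, ε * (|u.diff z| ^ D.p z * D.K z + |v.diff z| ^ D.p z * D.K z) := by
    rw [integral_const_mul, integral_add u.integrable_energy v.integrable_energy]
    rfl
  have e2 : C * D.pMax * (u.potential + v.potential - 2 * w.potential) =
      ∫ z, C * D.pMax * (|u.diff z| ^ D.p z / D.p z * D.K z + |v.diff z| ^ D.p z / D.p z * D.K z
        - 2 * (|w.diff z| ^ D.p z / D.p z * D.K z)) := by
    rw [integral_const_mul, integral_sub hS (w.integrable_potential.const_mul 2),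
      integral_add u.integrable_potential v.integrable_potential, integral_const_mul]
    rfl
  rw [energy_sub, e1, e2, ← integral_add hI hJ]
  refine integral_mono_ae (integrable_energy_sub u v) (hI.add hJ) ?_
  filter_upwards [D.ae_K_pos, diff_smul 2⁻¹ (u + v), diff_add u v] with z hz hd1 hd2
  have h1 := D.one_lt_p z
  have hwz : w.diff z = (u.diff z + v.diff z) / 2 := by
    rw [hw, hd1, hd2]
    ring
  set x := u.diff z
  set y := v.diff z
  have hmid := abs_rpow_midpoint_nonneg h1 x y
  have h3 : |x| ^ D.p z + |y| ^ D.p z - 2 * |(x + y) / 2| ^ D.p z ≤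
      D.pMax * (|x| ^ D.p z / D.p z + |y| ^ D.p z / D.p z
        - 2 * (|(x + y) / 2| ^ D.p z / D.p z)) := by
    have e : |x| ^ D.p z / D.p z + |y| ^ D.p z / D.p z - 2 * (|(x + y) / 2| ^ D.p z / D.p z) =
      (|x| ^ D.p z + |y| ^ D.p z - 2 * |(x + y) / 2| ^ D.p z) / D.p z := by ring
    rw [e, ← mul_div_assoc, le_div_iff₀ (by linarith), mul_comm]
    gcongr
    exact (D.p_mem_Icc z).2
  have h4 : |x - y| ^ D.p z ≤ ε * (|x| ^ D.p z + |y| ^ D.p z) + C *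
      (D.pMax * (|x| ^ D.p z / D.p z + |y| ^ D.p z / D.p z
        - 2 * (|(x + y) / 2| ^ D.p z / D.p z))) :=
    (h _ (D.p_mem_Icc z) x y).trans (by gcongr)
  simp only [hwz]
  refine (mul_le_mul_of_nonneg_right h4 hz.le).trans_eq ?_
  ring

/-- Every functional is attained, provided that the space is complete: minimise
`potential - f`. -/
theorem operator_surjective [CompleteSpace D.W₀] : Function.Surjective (operator (D := D)) := by
  intro f
  have hb := D.one_lt_pMax
  have hb0 : 0 < D.pMax := by linarith
  obtain ⟨R, hR, hRu⟩ := exists_mul_norm_le_energy D (D.pMax * (‖f‖ + 1))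
  have hfle : ∀ u : D.W₀, f u ≤ ‖f‖ * ‖u‖ := fun u => (le_abs_self _).trans (f.le_opNorm u)
  have hpot : ∀ u : D.W₀, 0 ≤ u.potential := fun u =>
    nonneg_of_mul_nonneg_right (u.energy_nonneg.trans u.energy_le_potential) hb0
  set Φ : D.W₀ → ℝ := fun u => u.potential - f u with hΦ
  have hlarge : ∀ u : D.W₀, R < ‖u‖ → 1 < Φ u := by
    intro u hu
    have h1 := (hRu u hu).trans u.energy_le_potential
    rw [mul_assoc, mul_le_mul_iff_right₀ hb0] at h1
    have := hfle u
    simp only [hΦ]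
    linarith
  have hbdd : BddBelow (range Φ) := by
    refine ⟨-(‖f‖ * R), ?_⟩
    rintro _ ⟨u, rfl⟩
    have hR' : 0 ≤ ‖f‖ * R := by positivity
    rcases le_or_gt ‖u‖ R with h | h
    · have h1 := hfle u
      have h2 : ‖f‖ * ‖u‖ ≤ ‖f‖ * R := by gcongr
      have := hpot u
      simp only [hΦ]
      linarith
    · linarith [hlarge u h]
  set m := ⨅ u, Φ u with hm
  have hmle : ∀ u, m ≤ Φ u := fun u => ciInf_le hbdd u
  have hex : ∀ n : ℕ, ∃ u, Φ u < m + 1 / ((n : ℝ) + 1) := fun n =>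
    exists_lt_of_ciInf_lt (lt_add_of_pos_right m Nat.one_div_pos_of_nat)
  choose u hu using hex
  have hΦ0 : Φ 0 = 0 := by
    have : (0 : D.W₀).potential = 0 := by
      have h0 : ∀ᵐ z, (0 : D.W₀).diff z = 0 := by
        filter_upwards [ae_prod_and (fn_zero (D := D))] with z hz
        rw [diff, hz.1, hz.2, sub_zero]
      refine integral_eq_zero_of_ae ?_
      filter_upwards [h0] with z hz
      rw [hz, abs_zero, Real.zero_rpow (by linarith [D.one_lt_p z])]
      simp
    simp [hΦ, this]
  -- `Φ 0 = 0` makes `m ≤ 0`, so `Φ (u n) < 1`, whereas `Φ > 1` outside the ball of radius `R`.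
  have hunorm : ∀ n, ‖u n‖ ≤ R := by
    intro n
    by_contra hne
    have h1 := hlarge _ (not_le.1 hne)
    have h2 := hu n
    have h3 := hmle 0
    have h4 : 1 / ((n : ℝ) + 1) ≤ 1 := by
      rw [div_le_one (by positivity)]
      linarith [(Nat.cast_nonneg n : (0 : ℝ) ≤ n)]
    linarith
  set M := (R + 1) ^ D.pMax with hM
  have hM0 : 0 < M := by positivity
  have huenergy : ∀ n, (u n).energy ≤ M := fun n =>
    energy_le_of_norm_lt_of_one_le (by linarith) (by linarith [hunorm n])
  have hcauchy : CauchySeq u := by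
    refine Metric.cauchySeq_iff.2 fun ε hε => ?_
    obtain ⟨δ, hδ, hδu⟩ := exists_energy_le_of_norm_le D hε
    obtain ⟨C, hC, hCu⟩ := energy_sub_le_potential D (show 0 < δ / (4 * M) by positivity)
    obtain ⟨n₀, hn₀⟩ := exists_nat_one_div_lt (show 0 < δ / (4 * C) by positivity)
    refine ⟨n₀, fun i hi j hj => ?_⟩
    rw [dist_eq_norm]
    refine hδu _ ((hCu (u i) (u j)).trans ?_)
    have hsmall : ∀ i, n₀ ≤ i → Φ (u i) ≤ m + δ / (4 * C) := fun i hi =>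
      (hu i).le.trans (by linarith [Nat.one_div_le_one_div (α := ℝ) hi])
    -- The midpoint has `Φ ≥ m`, and `f`, being linear, cancels from the midpoint defect.
    have h1 : (u i).potential + (u j).potential -
        2 * ((2⁻¹ : ℝ) • (u i + u j)).potential ≤ 2 * (δ / (4 * C)) := by
      have h2 := hmle ((2⁻¹ : ℝ) • (u i + u j))
      have h3 := hsmall i hi
      have h4 := hsmall j hj
      simp only [hΦ, map_smul, map_add, smul_eq_mul] at h2 h3 h4
      linarith
    calc _ ≤ δ / (4 * M) * (M + M) + C * (2 * (δ / (4 * C))) := by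
          gcongr
          · exact huenergy i
          · exact huenergy j
      _ = δ := by field_simp; ring
  obtain ⟨v, hv⟩ := cauchySeq_tendsto_of_complete hcauchy
  have hmin : Φ v ≤ m := by
    have h1 : Tendsto (fun n => v.potential + operator v (u n - v)) atTop (𝓝 v.potential) := by
      have := ((operator v).continuous.tendsto 0).comp (tendsto_sub_nhds_zero_iff.2 hv)
      simpa using tendsto_const_nhds.add this
    have h2 : Tendsto (fun n : ℕ => m + 1 / ((n : ℝ) + 1) + f (u n)) atTop (𝓝 (m + 0 + f v)) :=
      (tendsto_const_nhds.add tendsto_one_div_add_atTop_nhds_zero_nat).add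
        ((f.continuous.tendsto v).comp hv)
    have h3 := le_of_tendsto_of_tendsto' h1 h2 fun n => by
      have h4 := potential_tangent v (u n)
      have h5 := hu n
      simp only [hΦ] at h5
      linarith
    simp only [hΦ]
    linarith
  -- Minimality of `v` and the tangent at `v + t • φ` give `f φ ≤ 𝓛(v + tφ) φ` for `t > 0`;
  -- continuity of `𝓛` lets `t → 0`. Using `-φ` gives equality.
  have hle : ∀ φ : D.W₀, f φ ≤ operator v φ := by
    intro φ
    have h1 : Tendsto (fun t : ℝ => operator (v + t • φ) φ) (𝓝[>] 0) (𝓝 (operator v φ)) := by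
      have hc : Continuous fun t : ℝ => operator (v + t • φ) φ :=
        (operator_continuous.comp (by fun_prop : Continuous fun t : ℝ => v + t • φ)).clm_apply
          continuous_const
      have := (hc.tendsto 0).mono_left (nhdsWithin_le_nhds (s := Ioi 0))
      simpa using this
    refine ge_of_tendsto h1 ?_
    filter_upwards [self_mem_nhdsWithin] with t ht
    have h2 := potential_tangent (v + t • φ) v
    have h3 := hmin.trans (hmle (v + t • φ))
    have e : v - (v + t • φ) = (-t) • φ := by rw [neg_smul]; abel
    rw [e, map_smul, smul_eq_mul] at h2
    simp only [hΦ, map_add, map_smul, smul_eq_mul] at h3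
    have h4 : t * f φ ≤ t * operator (v + t • φ) φ := by linarith
    exact le_of_mul_le_mul_left h4 ht
  refine ⟨v, ContinuousLinearMap.ext fun φ => le_antisymm ?_ (hle φ)⟩
  have := hle (-φ)
  rw [map_neg, map_neg] at this
  linarith

theorem operator_isHomeomorph [CompleteSpace D.W₀] : IsHomeomorph (operator (D := D)) := by
  have hind : IsInducing (operator (D := D)) := by
    refine isInducing_iff_nhds.2 fun v => le_antisymm
      (operator_continuous.tendsto v).le_comap ?_
    refine ((Metric.nhds_basis_ball.comap operator).le_basis_iff Metric.nhds_basis_ball).2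
      fun ε hε => ?_
    obtain ⟨δ, hδ, h⟩ := exists_norm_sub_lt_of_operator v hε
    refine ⟨δ, hδ, fun u hu => ?_⟩
    rw [mem_preimage, Metric.mem_ball, dist_eq_norm] at hu
    rw [Metric.mem_ball, dist_eq_norm]
    exact h u hu
  exact isHomeomorph_iff_isEmbedding_surjective.2 ⟨⟨hind, operator_injective⟩, operator_surjective⟩

end W₀

end KernelSetting

/-! ### Fatou's lemma and a Poincaré inequality -/

namespace KernelSetting

variable {N : ℕ} (D : KernelSetting N)

theorem modular_le_of_tendsto {f : ℕ → EuclideanSpace ℝ (Fin N) → ℝ}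
    {g : EuclideanSpace ℝ (Fin N) → ℝ} (hf : ∀ k, AEMeasurable (f k) volume)
    (h : ∀ᵐ x, Tendsto (fun k => f k x) atTop (𝓝 (g x))) {C : ℝ≥0∞}
    (hC : ∀ᶠ k in atTop, D.modular (f k) ≤ C) : D.modular g ≤ C := by
  have h1 := lintegral_liminf_le' (μ := volume.restrict D.Q) (u := atTop)
    fun k => (D.aemeasurable_integrand (hf k)).restrict
  refine le_trans (le_of_eq ?_) (h1.trans (liminf_le_of_frequently_le' hC.frequently))
  refine lintegral_congr_ae (ae_restrict_of_ae ?_)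
  filter_upwards [ae_prod_and h] with z hz
  have hc : Continuous fun t : ℝ => ENNReal.ofReal (|t| ^ D.p z * D.K z) :=
    ENNReal.continuous_ofReal.comp ((continuous_abs.rpow_const fun _ =>
      Or.inr (by linarith [D.one_lt_p z])).mul continuous_const)
  exact (((hc.tendsto _).comp (hz.1.sub hz.2)).liminf_eq).symm

theorem exists_K_lower (M : ℝ) : ∃ c : ℝ, 0 < c ∧ ∀ x y, x ≠ y → ‖x - y‖ ≤ M → c ≤ D.K (x, y) := by
  obtain ⟨k₀, hk₀, hK⟩ := D.K_lower
  have hM : (1 : ℝ) ≤ max 1 M := le_max_left _ _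
  refine ⟨k₀ * max 1 M ^ (-((N : ℝ) + D.s * D.pMax)), by positivity, fun x y hxy h => ?_⟩
  have hpos : 0 < ‖x - y‖ := norm_pos_iff.2 (sub_ne_zero.2 hxy)
  refine le_trans ?_ (hK x y hxy)
  have hs := D.s_pos
  have hp := D.p_mem_Icc (x, y)
  have hp1 := D.one_lt_p (x, y)
  have hsp : 0 < D.s * D.p (x, y) := by positivity
  have hN : (0 : ℝ) ≤ N := Nat.cast_nonneg N
  refine mul_le_mul_of_nonneg_left ?_ hk₀.le
  calc max 1 M ^ (-((N : ℝ) + D.s * D.pMax)) ≤ max 1 M ^ (-((N : ℝ) + D.s * D.p (x, y))) := by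
        refine Real.rpow_le_rpow_of_exponent_le hM ?_
        have : D.s * D.p (x, y) ≤ D.s * D.pMax := mul_le_mul_of_nonneg_left hp.2 hs.le
        linarith
    _ ≤ _ := Real.rpow_le_rpow_of_nonpos hpos (h.trans (le_max_right _ _)) (by linarith)

/-- Provides a reference set at bounded distance from `Ω`, where functions of `W₀` vanish and `K` is
bounded below against `Ω`. -/
theorem exists_bounded_subset_compl : ∃ G : Set (EuclideanSpace ℝ (Fin N)), MeasurableSet G ∧
    Bornology.IsBounded G ∧ G ⊆ D.Ωᶜ ∧ volume G ≠ 0 := by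
  have h : ∃ n : ℕ, volume (D.Ωᶜ ∩ Metric.ball 0 n) ≠ 0 := by
    by_contra hne
    push Not at hne
    refine D.volume_compl_ne_zero ?_
    have := measure_iUnion_null hne
    rwa [← inter_iUnion, Metric.iUnion_ball_nat, inter_univ] at this
  obtain ⟨n, hn⟩ := h
  exact ⟨_, D.Ω_open.measurableSet.compl.inter measurableSet_ball,
    Metric.isBounded_ball.subset inter_subset_right, inter_subset_left, hn⟩

theorem le_one_add_abs_rpow {q : ℝ} (hq : 1 ≤ q) (t : ℝ) : |t| ≤ 1 + |t| ^ q := by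
  rcases le_total |t| 1 with h | h
  · linarith [Real.rpow_nonneg (abs_nonneg t) q]
  · have := Real.rpow_le_rpow_of_exponent_le h hq
    rw [Real.rpow_one] at this
    linarith

/-- A Poincaré inequality. -/
theorem exists_lintegral_le_modular : ∃ C : ℝ, 0 < C ∧
    ∀ u : EuclideanSpace ℝ (Fin N) → ℝ, AEMeasurable u volume →
      (∀ᵐ x, x ∉ D.Ω → u x = 0) →
      ∫⁻ x in D.Ω, ENNReal.ofReal |u x| ≤ ENNReal.ofReal C * (1 + D.modular u) := by
  obtain ⟨G, hG, hGb, hGΩ, hG0⟩ := D.exists_bounded_subset_compl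
  have hGtop : volume G ≠ ∞ := hGb.measure_lt_top.ne
  have hΩtop : volume D.Ω ≠ ∞ := D.Ω_bounded.measure_lt_top.ne
  obtain ⟨R, hR⟩ := D.Ω_bounded.exists_norm_le
  obtain ⟨R', hR'⟩ := hGb.exists_norm_le
  obtain ⟨c, hc, hcK⟩ := D.exists_K_lower (R + R')
  set g := (volume G).toReal with hg
  have hg0 : 0 < g := ENNReal.toReal_pos hG0 hGtop
  have hGg : volume G = ENNReal.ofReal g := (ENNReal.ofReal_toReal hGtop).symm
  set w := (volume D.Ω).toReal with hw
  have hw0 : 0 ≤ w := ENNReal.toReal_nonneg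
  have hΩw : volume D.Ω = ENNReal.ofReal w := (ENNReal.ofReal_toReal hΩtop).symm
  refine ⟨w + g⁻¹ * c⁻¹, by positivity, fun u hu hu0 => ?_⟩
  have hF := D.aemeasurable_integrand hu
  have hsub : D.Ω ×ˢ G ⊆ D.Q := fun z hz => ⟨mem_univ _, fun h => h.1 hz.1⟩
  -- For `y ∈ G` one has `u y = 0`, hence `|u x| ≤ 1 + |u x - u y| ^ p` and `K ≥ c`. Integrating
  -- over `Ω × G` and dividing by the measure `g` of `G` gives the estimate.
  have key : ∫⁻ z in D.Ω ×ˢ G, ENNReal.ofReal |u z.1| ≤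
      ∫⁻ z in D.Ω ×ˢ G, (1 + ENNReal.ofReal c⁻¹ *
        ENNReal.ofReal (|u z.1 - u z.2| ^ D.p z * D.K z)) := by
    refine setLIntegral_mono_ae (aemeasurable_const.add (hF.const_mul _)).restrict ?_
    filter_upwards [ae_prod_and hu0] with z hz hzG
    have hz2 : z.2 ∉ D.Ω := hGΩ hzG.2
    have hne : z.1 ≠ z.2 := fun e => hz2 (e ▸ hzG.1)
    have hK := hcK z.1 z.2 hne ((norm_sub_le _ _).trans (add_le_add (hR _ hzG.1) (hR' _ hzG.2)))
    rw [hz.2 hz2, sub_zero, ← ENNReal.ofReal_one, ← ENNReal.ofReal_mul (by positivity),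
      ← ENNReal.ofReal_add zero_le_one
        (mul_nonneg (by positivity) (mul_nonneg (by positivity) (hc.le.trans hK)))]
    refine ENNReal.ofReal_le_ofReal ((le_one_add_abs_rpow (D.one_lt_p z).le _).trans ?_)
    gcongr
    rw [← div_eq_inv_mul, le_div_iff₀ hc]
    exact mul_le_mul_of_nonneg_left hK (by positivity)
  have e1 : ∫⁻ z in D.Ω ×ˢ G, ENNReal.ofReal |u z.1| =
      (∫⁻ x in D.Ω, ENNReal.ofReal |u x|) * volume G := by
    have hm : AEMeasurable (fun x => ENNReal.ofReal |u x|) (volume.restrict D.Ω) :=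
      hu.norm.ennreal_ofReal.restrict
    rw [Measure.volume_eq_prod, ← Measure.prod_restrict]
    have := lintegral_prod_mul (ν := volume.restrict G) hm (aemeasurable_const (b := (1 : ℝ≥0∞)))
    simpa using this
  have e2 : ∫⁻ z in D.Ω ×ˢ G, (1 + ENNReal.ofReal c⁻¹ *
        ENNReal.ofReal (|u z.1 - u z.2| ^ D.p z * D.K z)) ≤
      volume D.Ω * volume G + ENNReal.ofReal c⁻¹ * D.modular u := by
    rw [lintegral_add_left' aemeasurable_const, lintegral_const_mul' _ _ ENNReal.ofReal_ne_top,
      setLIntegral_const, one_mul, Measure.volume_eq_prod, Measure.prod_prod]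
    gcongr
    exact lintegral_mono_set hsub
  rw [e1] at key
  have h3 := key.trans e2
  rw [hGg, hΩw] at h3
  have h4 : ∫⁻ x in D.Ω, ENNReal.ofReal |u x| ≤
      ENNReal.ofReal w + ENNReal.ofReal (g⁻¹ * c⁻¹) * D.modular u := by
    have hgne : ENNReal.ofReal g ≠ 0 := by simpa using hg0
    rw [← ENNReal.mul_le_mul_iff_left hgne ENNReal.ofReal_ne_top]
    refine h3.trans_eq ?_
    have e3 : ENNReal.ofReal (g⁻¹ * c⁻¹) * ENNReal.ofReal g = ENNReal.ofReal c⁻¹ := by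
      rw [← ENNReal.ofReal_mul (by positivity)]
      congr 1
      field_simp
    rw [add_mul, mul_right_comm _ (D.modular u), e3]
  refine h4.trans ?_
  rw [mul_add, mul_one]
  gcongr
  · have : 0 < g⁻¹ * c⁻¹ := by positivity
    linarith
  · linarith

/-! ### Gain of integrability near the diagonal -/

theorem exists_uniform_exponent {η : ℝ} (hη : 0 < η) : ∃ δ : ℝ, 0 < δ ∧
    ∀ x ∈ D.Ω, ∀ y, ‖x - y‖ < δ → D.p (x, x) ≤ D.p (x, y) + η := by
  obtain ⟨R, hR⟩ := D.Ω_bounded.exists_norm_le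
  have hc := ((isCompact_closedBall (0 : EuclideanSpace ℝ (Fin N)) (R + 1)).prod
    (isCompact_closedBall 0 (R + 1))).uniformContinuousOn_of_continuous
      D.p_continuous.continuousOn
  obtain ⟨δ, hδ, h⟩ := Metric.uniformContinuousOn_iff.1 hc η hη
  -- The cap `1` keeps `y` in the closed ball of radius `R + 1`, where `p` is uniformly continuous.
  refine ⟨min δ 1, lt_min hδ one_pos, fun x hx y hxy => ?_⟩
  have hxR := hR x hx
  have hy : ‖y‖ ≤ R + 1 := by
    have h1 := norm_sub_norm_le y x
    rw [norm_sub_rev] at h1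
    linarith [min_le_right δ 1]
  have hxB : x ∈ Metric.closedBall (0 : EuclideanSpace ℝ (Fin N)) (R + 1) := by
    rw [mem_closedBall_zero_iff]
    linarith
  have h1 := h (x, x) ⟨hxB, hxB⟩ (x, y) ⟨hxB, mem_closedBall_zero_iff.2 hy⟩ (by
    rw [Prod.dist_eq, dist_self, max_lt_iff]
    exact ⟨hδ, by rw [dist_eq_norm]; exact hxy.trans_le (min_le_left _ _)⟩)
  rw [Real.dist_eq] at h1
  linarith [(abs_lt.1 h1).2]

/-- The gain of integrability near the diagonal at the scale `r` with `r ^ N = κ / T`. -/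
theorem rpow_gain {n s q P b κ T r d t k₀ k : ℝ} (hn : 0 < n) (hs : 0 < s) (hq : 1 < q)
    (hqb : q ≤ b) (hP : P ≤ q + s / n) (hκ : 1 ≤ κ) (hT : 1 ≤ T) (hr : 0 < r)
    (hrn : r ^ n = κ / T) (hd : 0 < d) (hdr : d ≤ r) (ht : T / 2 ≤ t) (hk₀ : 0 < k₀)
    (hk : k₀ * d ^ (-(n + s * q)) ≤ k) :
    k₀ * 2 ^ (-b) * κ ^ (-(1 + s * b / n)) * T * T ^ P ≤ t ^ q * k := by
  have hT0 : 0 < T := by linarith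
  have hκ0 : 0 < κ := by linarith
  have h1 : κ ^ (-(1 + s * b / n)) * T ^ (1 + s * q / n) ≤ d ^ (-(n + s * q)) := by
    have e : r ^ (-(n + s * q)) = κ ^ (-(1 + s * q / n)) * T ^ (1 + s * q / n) := by
      have e1 : -(n + s * q) = n * (-(1 + s * q / n)) := by field_simp
      rw [e1, Real.rpow_mul hr.le, hrn, Real.div_rpow hκ0.le hT0.le, Real.rpow_neg hT0.le,
        div_inv_eq_mul]
    calc _ ≤ κ ^ (-(1 + s * q / n)) * T ^ (1 + s * q / n) := by
          gcongr
      _ = r ^ (-(n + s * q)) := e.symm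
      _ ≤ _ := Real.rpow_le_rpow_of_nonpos hd hdr (by nlinarith)
  have h2 : 2 ^ (-b) * T ^ q ≤ t ^ q := by
    calc 2 ^ (-b) * T ^ q ≤ 2 ^ (-q) * T ^ q := by
          gcongr
          norm_num
      _ = (T / 2) ^ q := by
          rw [Real.div_rpow hT0.le two_pos.le, Real.rpow_neg two_pos.le, ← div_eq_inv_mul]
      _ ≤ t ^ q := by gcongr
  -- The gain `s q / n` in the exponent exceeds the allowed oscillation `s / n` of the exponent
  -- because `q > 1`.
  have h3 : T * T ^ P ≤ T ^ q * T ^ (1 + s * q / n) := by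
    rw [← Real.rpow_add hT0]
    nth_rw 1 [← Real.rpow_one T]
    rw [← Real.rpow_add hT0]
    refine Real.rpow_le_rpow_of_exponent_le hT ?_
    have : s / n ≤ s * q / n := by
      gcongr
      nlinarith
    linarith
  have ht0 : 0 < t := by linarith
  calc _ = k₀ * 2 ^ (-b) * κ ^ (-(1 + s * b / n)) * (T * T ^ P) := by ring
    _ ≤ k₀ * 2 ^ (-b) * κ ^ (-(1 + s * b / n)) * (T ^ q * T ^ (1 + s * q / n)) := by gcongr
    _ = (2 ^ (-b) * T ^ q) * (k₀ * (κ ^ (-(1 + s * b / n)) * T ^ (1 + s * q / n))) := by ring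
    _ ≤ t ^ q * (k₀ * d ^ (-(n + s * q))) := by gcongr
    _ ≤ t ^ q * k := by gcongr

/-- An integrable function is small on at least a part of every large ball. -/
theorem volume_ball_inter_le {u : EuclideanSpace ℝ (Fin N) → ℝ} (hu : Measurable u)
    {C T : ℝ} (hT : 0 < T) (hC : ∫⁻ x, ENNReal.ofReal |u x| ≤ ENNReal.ofReal C)
    {x : EuclideanSpace ℝ (Fin N)} {r : ℝ}
    (hr : ENNReal.ofReal (4 * C / T) ≤ volume (Metric.ball x r)) :
    ENNReal.ofReal (2 * C / T) ≤ volume (Metric.ball x r ∩ {y | |u y| ≤ T / 2}) := by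
  -- By Chebyshev the bad set has measure at most `2C / T`, half of the lower bound for the ball.
  have hlarge : volume {y | ENNReal.ofReal (T / 2) ≤ ENNReal.ofReal |u y|} ≤
      ENNReal.ofReal (2 * C / T) := by
    have h1 := (mul_meas_ge_le_lintegral (μ := volume) (f := fun x => ENNReal.ofReal |u x|)
      hu.norm.ennreal_ofReal (ENNReal.ofReal (T / 2))).trans hC
    have hne : ENNReal.ofReal (T / 2) ≠ 0 := by simpa using hT
    rw [← ENNReal.mul_le_mul_iff_right hne ENNReal.ofReal_ne_top]
    refine h1.trans_eq ?_
    rw [← ENNReal.ofReal_mul (by positivity)]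
    congr 1
    field_simp
  have hsub : Metric.ball x r \ {y | ENNReal.ofReal (T / 2) ≤ ENNReal.ofReal |u y|} ⊆
      Metric.ball x r ∩ {y | |u y| ≤ T / 2} := by
    refine fun y hy => ⟨hy.1, ?_⟩
    by_contra hne
    exact hy.2 (ENNReal.ofReal_le_ofReal (not_le.1 hne).le)
  refine le_trans ?_ ((le_measure_sdiff).trans (measure_mono hsub))
  refine le_trans ?_ (tsub_le_tsub hr hlarge)
  rcases le_or_gt C 0 with h | h
  · rw [ENNReal.ofReal_of_nonpos (div_nonpos_of_nonpos_of_nonneg (by linarith) hT.le)]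
    exact zero_le
  · rw [← ENNReal.ofReal_sub _ (by positivity)]
    refine ENNReal.ofReal_le_ofReal (le_of_eq ?_)
    ring

/-- The embedding of `W₀^{K, p(x, y)}(Ω)` into `L^{p(x, x)}(Ω)`. -/
theorem lintegral_rpow_lt_top {u : EuclideanSpace ℝ (Fin N) → ℝ} (hu : Measurable u)
    (hint : ∫⁻ x, ENNReal.ofReal |u x| < ∞) (hmod : D.modular u < ∞) :
    ∫⁻ x in D.Ω, ENNReal.ofReal (|u x| ^ D.p (x, x)) < ∞ := by
  have : Nonempty (Fin N) := ⟨⟨0, D.N_pos⟩⟩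
  have hN : (0 : ℝ) < N := Nat.cast_pos.2 D.N_pos
  have hs := D.s_pos
  obtain ⟨k₀, hk₀, hK⟩ := D.K_lower
  obtain ⟨δ, hδ, hp⟩ := D.exists_uniform_exponent (div_pos hs hN)
  set B := volume (Metric.ball (0 : EuclideanSpace ℝ (Fin N)) 1) with hB
  have hBtop : B ≠ ∞ := measure_ball_lt_top.ne
  set w := B.toReal with hw
  have hw0 : 0 < w := ENNReal.toReal_pos (Metric.measure_ball_pos _ _ one_pos).ne' hBtop
  have hBw : B = ENNReal.ofReal w := (ENNReal.ofReal_toReal hBtop).symm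
  set I := ∫⁻ x, ENNReal.ofReal |u x| with hI
  -- Adding `w` makes `C` positive and `κ = 4C / w` at least `1`; a ball with `r ^ N = κ / T` then
  -- has volume exactly `4C / T`.
  set C := I.toReal + w with hC
  have hC0 : 0 < C := add_pos_of_nonneg_of_pos ENNReal.toReal_nonneg hw0
  have hIC : I ≤ ENNReal.ofReal C := by
    rw [← ENNReal.ofReal_toReal hint.ne]
    exact ENNReal.ofReal_le_ofReal (by linarith)
  set κ := 4 * C / w with hκ
  have hκ1 : 1 ≤ κ := by
    rw [hκ, le_div_iff₀ hw0]
    have : 0 ≤ I.toReal := ENNReal.toReal_nonneg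
    linarith
  have hκ0 : 0 < κ := by linarith
  -- Heights `T ≥ T₀` correspond to radii `r ≤ δ`, where `p(x, x) ≤ p(x, y) + s / N`.
  set T₀ := max 1 (κ / δ ^ (N : ℝ)) with hT₀
  have hT₀1 : 1 ≤ T₀ := le_max_left _ _
  set c := k₀ * 2 ^ (-D.pMax) * κ ^ (-(1 + D.s * D.pMax / N)) with hc
  have hc0 : 0 < c := by positivity
  set F : EuclideanSpace ℝ (Fin N) × EuclideanSpace ℝ (Fin N) → ℝ≥0∞ :=
    fun z => ENNReal.ofReal (|u z.1 - u z.2| ^ D.p z * D.K z) with hF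
  -- With `T = |u x|`, a part of the ball of measure at least `2C / T` has `|u y| ≤ T / 2`. There
  -- the jump is at least `T / 2` and the integrand at least `c T · T ^ p(x, x)`; the measure `2C /
  -- T` cancels the extra `T`.
  have hlower : ∀ x ∈ D.Ω, T₀ ≤ |u x| →
      ENNReal.ofReal (2 * C * c * |u x| ^ D.p (x, x)) ≤ ∫⁻ y, F (x, y) := by
    intro x hx hux
    set T := |u x| with hT
    have hT1 : 1 ≤ T := hT₀1.trans hux
    have hT0 : 0 < T := by linarith
    set r := (κ / T) ^ ((N : ℝ)⁻¹) with hr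
    have hr0 : 0 < r := by positivity
    have hrn : r ^ (N : ℝ) = κ / T := Real.rpow_inv_rpow (by positivity) hN.ne'
    have hrδ : r ≤ δ := by
      rw [hr, Real.rpow_inv_le_iff_of_pos (by positivity) hδ.le hN, div_le_iff₀ hT0,
        ← div_le_iff₀' (by positivity)]
      exact (le_max_right _ _).trans hux
    have hball : volume (Metric.ball x r) = ENNReal.ofReal (4 * C / T) := by
      rw [Measure.addHaar_ball _ _ hr0.le, finrank_euclideanSpace_fin, ← hB, hBw,
        ← ENNReal.ofReal_mul (by positivity), ← Real.rpow_natCast, hrn, hκ]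
      congr 1
      field_simp
    set S := Metric.ball x r ∩ {y | |u y| ≤ T / 2} with hS
    have hSm : MeasurableSet S := measurableSet_ball.inter
      (measurableSet_le hu.norm measurable_const)
    have hSv : ENNReal.ofReal (2 * C / T) ≤ volume S :=
      volume_ball_inter_le hu hT0 hIC hball.ge
    have hFS : ∀ y ∈ S, ENNReal.ofReal (c * T * T ^ D.p (x, x)) ≤ F (x, y) := by
      intro y hy
      have hxy : ‖x - y‖ < r := by
        have := hy.1
        rwa [Metric.mem_ball, dist_comm, dist_eq_norm] at this
      have huy : |u y| ≤ T / 2 := hy.2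
      have hne : x ≠ y := by
        rintro rfl
        linarith
      have ht : T / 2 ≤ |u x - u y| := by
        have := abs_sub_abs_le_abs_sub (u x) (u y)
        linarith
      exact ENNReal.ofReal_le_ofReal (rpow_gain hN hs (D.one_lt_p (x, y)) (D.p_mem_Icc (x, y)).2
        (hp x hx y (hxy.trans_le hrδ)) hκ1 hT1 hr0 hrn (norm_pos_iff.2 (sub_ne_zero.2 hne))
        hxy.le ht hk₀ (hK x y hne))
    calc ENNReal.ofReal (2 * C * c * T ^ D.p (x, x))
        = ENNReal.ofReal (c * T * T ^ D.p (x, x)) * ENNReal.ofReal (2 * C / T) := by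
          rw [← ENNReal.ofReal_mul (by positivity)]
          congr 1
          field_simp
      _ ≤ ENNReal.ofReal (c * T * T ^ D.p (x, x)) * volume S := by gcongr
      _ = ∫⁻ y in S, ENNReal.ofReal (c * T * T ^ D.p (x, x)) := (setLIntegral_const _ _).symm
      _ ≤ ∫⁻ y in S, F (x, y) := setLIntegral_mono' hSm hFS
      _ ≤ ∫⁻ y, F (x, y) := setLIntegral_le_lintegral _ _
  have hpt : ∀ x ∈ D.Ω, ENNReal.ofReal (|u x| ^ D.p (x, x)) ≤
      ENNReal.ofReal (T₀ ^ D.pMax) + ENNReal.ofReal (2 * C * c)⁻¹ * ∫⁻ y, F (x, y) := by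
    intro x hx
    rcases le_or_gt T₀ |u x| with h | h
    · refine le_add_left ?_
      calc _ = ENNReal.ofReal (2 * C * c)⁻¹ *
            ENNReal.ofReal (2 * C * c * |u x| ^ D.p (x, x)) := by
            rw [← ENNReal.ofReal_mul (by positivity), inv_mul_cancel_left₀ (by positivity)]
        _ ≤ _ := by
            gcongr
            exact hlower x hx h
    · refine le_add_right (ENNReal.ofReal_le_ofReal ?_)
      calc |u x| ^ D.p (x, x) ≤ T₀ ^ D.p (x, x) := by
            gcongr
            linarith [D.one_lt_p (x, x)]
        _ ≤ T₀ ^ D.pMax := Real.rpow_le_rpow_of_exponent_le hT₀1 (D.p_mem_Icc _).2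
  have hFm : AEMeasurable F ((volume.restrict D.Ω).prod volume) := by
    have h1 : AEMeasurable F (volume.restrict (D.Ω ×ˢ univ)) :=
      (D.aemeasurable_integrand hu.aemeasurable).restrict
    rwa [Measure.volume_eq_prod, ← Measure.prod_restrict, Measure.restrict_univ] at h1
  have hFQ : ∫⁻ x in D.Ω, ∫⁻ y, F (x, y) ≤ D.modular u := by
    rw [← lintegral_prod _ hFm]
    have e : (volume.restrict D.Ω).prod (volume : Measure (EuclideanSpace ℝ (Fin N))) =
        volume.restrict (D.Ω ×ˢ univ) := by
      rw [Measure.volume_eq_prod, ← Measure.prod_restrict, Measure.restrict_univ]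
    rw [e]
    exact lintegral_mono_set fun z hz => ⟨mem_univ _, fun h => h.1 hz.1⟩
  calc _ ≤ ∫⁻ x in D.Ω, (ENNReal.ofReal (T₀ ^ D.pMax) +
        ENNReal.ofReal (2 * C * c)⁻¹ * ∫⁻ y, F (x, y)) :=
        setLIntegral_mono' D.Ω_open.measurableSet hpt
    _ = ENNReal.ofReal (T₀ ^ D.pMax) * volume D.Ω +
        ENNReal.ofReal (2 * C * c)⁻¹ * ∫⁻ x in D.Ω, ∫⁻ y, F (x, y) := by
        rw [lintegral_add_left' aemeasurable_const,
          lintegral_const_mul' _ _ ENNReal.ofReal_ne_top, setLIntegral_const]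
    _ < ∞ := ENNReal.add_lt_top.2
        ⟨ENNReal.mul_lt_top ENNReal.ofReal_lt_top D.Ω_bounded.measure_lt_top,
          ENNReal.mul_lt_top ENNReal.ofReal_lt_top (hFQ.trans_lt hmod)⟩

/-! ### Embedding into `L¹` and completeness -/

namespace W₀

variable {D}

theorem lintegral_abs_fn (u : D.W₀) :
    ∫⁻ x, ENNReal.ofReal |u.fn x| = ∫⁻ x in D.Ω, ENNReal.ofReal |u.fn x| := by
  rw [← lintegral_indicator D.Ω_open.measurableSet]
  refine lintegral_congr_ae ?_
  filter_upwards [u.mem.zero_outside] with x hx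
  by_cases h : x ∈ D.Ω
  · rw [indicator_of_mem h]
  · rw [indicator_of_notMem h, hx h, abs_zero, ENNReal.ofReal_zero]

theorem exists_lintegral_le_energy (D : KernelSetting N) : ∃ C : ℝ, 0 < C ∧ ∀ u : D.W₀,
    ∫⁻ x, ENNReal.ofReal |u.fn x| ≤ ENNReal.ofReal (C * (1 + u.energy)) := by
  obtain ⟨C, hC, h⟩ := D.exists_lintegral_le_modular
  refine ⟨C, hC, fun u => ?_⟩
  rw [lintegral_abs_fn, ENNReal.ofReal_mul hC.le, ENNReal.ofReal_add zero_le_one u.energy_nonneg,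
    ENNReal.ofReal_one, ← modular_eq_energy]
  exact h _ u.mem.measurable u.mem.zero_outside

theorem integrable_fn (u : D.W₀) : Integrable u.fn volume := by
  obtain ⟨C, hC, h⟩ := exists_lintegral_le_energy D
  refine ⟨u.mem.measurable.aestronglyMeasurable, ?_⟩
  rw [hasFiniteIntegral_iff_norm]
  exact (h u).trans_lt ENNReal.ofReal_lt_top

/-- The embedding of `W₀^{K, p(x, y)}(Ω)` into `L¹`. -/
theorem exists_toL1 (D : KernelSetting N) :
    ∃ T : D.W₀ →L[ℝ] Lp ℝ 1 (volume : Measure (EuclideanSpace ℝ (Fin N))),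
      ∀ u : D.W₀, T u =ᵐ[volume] u.fn := by
  obtain ⟨C, hC, h⟩ := exists_lintegral_le_energy D
  let T : D.W₀ →ₗ[ℝ] Lp ℝ 1 (volume : Measure (EuclideanSpace ℝ (Fin N))) :=
    { toFun := fun u => u.integrable_fn.toL1 u.fn
      map_add' := fun u v => by
        rw [← Integrable.toL1_add, Integrable.toL1_eq_toL1_iff]
        exact fn_add u v
      map_smul' := fun c u => by
        rw [RingHom.id_apply, ← Integrable.toL1_smul, Integrable.toL1_eq_toL1_iff]
        exact fn_smul c u }
  refine ⟨T.mkContinuous (C * 2) (norm_le_mul_norm T (by positivity) fun φ hφ => ?_), fun u =>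
    u.integrable_fn.coeFn_toL1⟩
  change ‖φ.integrable_fn.toL1 φ.fn‖ ≤ C * 2
  rw [Integrable.norm_toL1_eq_lintegral_norm]
  refine ENNReal.toReal_le_of_le_ofReal (by positivity) ((h φ).trans (ENNReal.ofReal_le_ofReal ?_))
  gcongr
  linarith

/-- The space `W₀^{K, p(x, y)}(Ω)` is complete. -/
instance : CompleteSpace D.W₀ := by
  refine Metric.complete_of_cauchySeq_tendsto fun u hu => ?_
  obtain ⟨T, hT⟩ := exists_toL1 D
  obtain ⟨g, hg⟩ := cauchySeq_tendsto_of_complete (T.uniformContinuous.comp_cauchySeq hu)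
  obtain ⟨ns, hns, hae⟩ := (tendstoInMeasure_of_tendsto_Lp hg).exists_seq_tendsto_ae
  have hlim : ∀ᵐ x, Tendsto (fun k => (u (ns k)).fn x) atTop (𝓝 (g x)) := by
    filter_upwards [hae, ae_all_iff.2 fun n => hT (u n)] with x hx hTx
    refine hx.congr fun k => ?_
    exact hTx (ns k)
  have hmeas : ∀ v : D.W₀, AEMeasurable v.fn volume := fun v => v.mem.measurable
  obtain ⟨R, hR⟩ := hu.isBounded_range.exists_norm_le
  have hmod : D.modular g < ∞ := by
    refine lt_of_le_of_lt (D.modular_le_of_tendsto (fun k => hmeas (u (ns k))) hlim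
      (C := ENNReal.ofReal ((|R| + 1) ^ D.pMax)) (Eventually.of_forall fun k => ?_))
      ENNReal.ofReal_lt_top
    rw [modular_eq_energy]
    have := hR _ (mem_range_self (ns k))
    exact ENNReal.ofReal_le_ofReal (energy_le_of_norm_lt_of_one_le
      (by linarith [abs_nonneg R]) (by linarith [le_abs_self R]))
  have hgm : Measurable g := (Lp.stronglyMeasurable g).measurable
  have hgint : ∫⁻ x, ENNReal.ofReal |g x| < ∞ := by
    have := (L1.integrable_coeFn g).hasFiniteIntegral
    rwa [hasFiniteIntegral_iff_norm] at this
  -- The norm sees only the modular, so membership of the limit in `L^{p(x,x)}(Ω)` has to be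
  -- recovered from finite modular and integrability.
  have hgmem : D.MemW₀ g :=
    { measurable := hgm.aemeasurable
      lebesgue := D.lintegral_rpow_lt_top hgm hgint hmod
      finite := ⟨1, one_pos, by simpa using hmod⟩
      zero_outside := by
        filter_upwards [hlim, ae_all_iff.2 fun n => (u n).mem.zero_outside] with x hx h0 hxΩ
        refine tendsto_nhds_unique hx ?_
        simp only [h0 _ hxΩ, tendsto_const_nhds] }
  let v : D.W₀ := ⟨(g : EuclideanSpace ℝ (Fin N) →ₘ[volume] ℝ), hgmem⟩
  refine ⟨v, Metric.tendsto_atTop.2 fun ε hε => ?_⟩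
  obtain ⟨n₀, hn₀⟩ := Metric.cauchySeq_iff.1 hu (ε / 2) (half_pos hε)
  refine ⟨n₀, fun n hn => ?_⟩
  rw [dist_eq_norm]
  refine lt_of_le_of_lt (norm_le_of_energy_le_one (half_pos hε) ?_) (half_lt_self hε)
  have hsub : ∀ a b : D.W₀, ((ε / 2)⁻¹ • (a - b)).fn =ᵐ[volume]
      fun x => (ε / 2)⁻¹ * (a.fn x - b.fn x) := fun a b => by
    have e : (ε / 2)⁻¹ • (a - b) = (ε / 2)⁻¹ • (a + (-1 : ℝ) • b) := by
      rw [neg_one_smul, sub_eq_add_neg]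
    rw [e]
    filter_upwards [fn_smul (ε / 2)⁻¹ (a + (-1 : ℝ) • b), fn_add a ((-1 : ℝ) • b),
      fn_smul (-1) b] with x h1 h2 h3
    rw [h1, h2, h3]
    ring
  rw [← ENNReal.ofReal_le_one, ← modular_eq_energy]
  -- Fatou in `k` with `n` fixed: the Cauchy bound `‖u n - u (ns k)‖ < ε / 2` says that these
  -- rescaled differences have energy at most `1`.
  refine D.modular_le_of_tendsto (f := fun k => ((ε / 2)⁻¹ • (u n - u (ns k))).fn)
    (fun k => hmeas _) ?_ ?_
  · filter_upwards [hlim, hsub (u n) v, ae_all_iff.2 fun k => hsub (u n) (u (ns k))]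
      with x hx h1 h2
    simp only [h1, h2]
    exact (tendsto_const_nhds.sub hx).const_mul _
  · filter_upwards [eventually_ge_atTop n₀] with k hk
    have h1 := hn₀ n hn (ns k) (hk.trans (hns.id_le k))
    rw [dist_eq_norm] at h1
    rw [modular_eq_energy, ENNReal.ofReal_le_one]
    exact energy_le_one_of_norm_lt h1

end W₀

end KernelSetting

theorem lemma4p1 {N : ℕ} (D : KernelSetting N) :
    -- the integral that defines the operator converges, and it defines an element of the dual
    (∀ u φ : D.W₀, Integrable (D.integrand u.fn φ.fn) volume) ∧
    ∃ L : D.W₀ → StrongDual ℝ D.W₀,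
      (∀ u φ : D.W₀, L u φ = ∫ z, D.integrand u.fn φ.fn z) ∧
      -- bounded: bounded sets are mapped to bounded sets
      (∀ B : Set D.W₀, Bornology.IsBounded B → Bornology.IsBounded (L '' B)) ∧
      -- strictly monotone
      (∀ u v : D.W₀, u ≠ v → 0 < (L u - L v) (u - v)) ∧
      -- of type (S₊)
      (∀ (u : ℕ → D.W₀) (v : D.W₀),
        (∀ f : StrongDual ℝ D.W₀, Tendsto (fun k => f (u k)) atTop (𝓝 (f v))) →
        limsup (fun k => (((L (u k) - L v) (u k - v) : ℝ) : EReal)) atTop ≤ 0 →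
        Tendsto u atTop (𝓝 v)) ∧
      -- a homeomorphism onto the dual
      IsHomeomorph L ∧
      -- coercive
      Tendsto (fun u : D.W₀ => L u u / ‖u‖) (Bornology.cobounded D.W₀) atTop := by
  refine ⟨KernelSetting.W₀.integrable_integrand, KernelSetting.W₀.operator, fun u φ => rfl,
    fun B hB => KernelSetting.W₀.operator_bounded hB,
    fun u v huv => KernelSetting.W₀.operator_monotone huv,
    fun u v _ h => KernelSetting.W₀.tendsto_of_limsup_pairing_le h,
    KernelSetting.W₀.operator_isHomeomorph, KernelSetting.W₀.operator_coercive⟩
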